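/- **Setting.** Assume $2^{\omega_1}=\omega_2$ and fix a bijection $\pi:\omega_2\to H(\omega_2)$. Let $\mathcal Y$ be a stationary subset of $P_{\omega_1}(\omega_2)$ (the set of countable subsets of $\omega_2$) which is thin, i.e. $|\{a\cap\beta : a\in\mathcal Y\}|\le\omega_1$ for every $\beta<\omega_2$, and closed under initial segments. Let $\mathcal A=(H(\omega_2),\in,\pi,\mathcal Y)$, and for $a\subseteq H(\omega_2)$ let $Sk(a)$ be the closure of $a$ under the definable Skolem functions of $\mathcal A$ that choose the first witness in the well-ordering of $H(\omega_2)$ given by $\pi$. Let $C=\{\beta<\omega_2 : Sk(\beta)\cap\omega_2=\beta\}$, let $\Lambda$ be the set of $\beta<\omega_2$ of cofinality $\omega_1$ which are limit points of $C$, and fix $\Gamma\subseteq\Lambda$ stationary in $\omega_2$. Let $\mathcal X$ be the set of $M\in\mathcal Y$ with $Sk(M)\cap\omega_2=M$ and $\sup(C\cap\gamma)\in M$ for all $\gamma\in M$. For $M,N\in\mathcal X$ let $\Gamma_M=\{\beta\in\Gamma : \beta=\min(\Gamma\setminus\sup(M\cap\beta))\}$ and let $\beta_{M,N}=\max(\Gamma_M\cap\Gamma_N)$.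 A set $A\subseteq\mathcal X$ is *adequate* if for all $M,N\in A$, either $M\cap\beta_{M,N}=N\cap\beta_{M,N}$, or $M\cap\beta_{M,N}\in Sk(N)$, or $N\cap\beta_{M,N}\in Sk(M)$. Let $\mathbb P$ be the poset of finite adequate sets, with $B\le A$ iff $A\subseteq B$. For a forcing poset $\mathbb Q$ and a set $N$, a condition $q\in\mathbb Q$ is *strongly $(N,\mathbb Q)$-generic* if every dense subset $D$ of the poset $N\cap\mathbb Q$ is predense in $\mathbb Q$ below $q$. The poset $\mathbb Q$ is *strongly proper on a stationary set* if for every sufficiently large regular cardinal $\theta$ with $\mathbb Q\subseteq H(\theta)$ there are stationarily many countable $N\prec H(\theta)$ such that every $p\in N\cap\mathbb Q$ has a strongly $(N,\mathbb Q)$-generic extension $q\le p$. **Proposition 4.2.** 1. The poset $\mathbb P$ is strongly proper on a stationary set. 2. Let $\theta>\omega_2$ be a regular cardinal and let $N^*\prec H(\theta)$ be countable with $\mathbb P,\pi,\mathcal X\in N^*$ and $N:=N^*\cap\omega_2\in\mathcal X$. Then for every $A\in N^*\cap\mathbb P$, the set $A\cup\{N\}$ is a condition of $\mathbb P$ which extends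 $A$ and is strongly $(N^*,\mathbb P)$-generic. 3. In particular, $\mathbb P$ preserves $\omega_1$: every condition forces that $\omega_1$ (of the ground model) is a cardinal. -/

import Mathlib

open Cardinal Ordinal

universe u v

namespace AdequateForcing

/-! ### Clubs and stationary sets of countable sets -/

section Clubs

variable {α : Type v}

/-- `C` is a club subset of `P_{ω₁}(X)`, the family of countable subsets of `X`: it is cofinal and
closed under unions of increasing `ω`-chains (equivalently, of chains of any countable length). -/
structure IsClubOfCountable (X : Set α) (C : Set (Set α)) : Prop where
  subset : ∀ a ∈ C, a ⊆ X ∧ a.Countable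
  cofinal : ∀ b : Set α, b ⊆ X → b.Countable → ∃ a ∈ C, b ⊆ a
  closed : ∀ f : ℕ → Set α, Monotone f → (∀ n, f n ∈ C) → (⋃ n, f n) ∈ C

/-- `S` is stationary in `P_{ω₁}(X)`: it meets every club subset of `P_{ω₁}(X)`. -/
def IsStationaryOfCountable (X : Set α) (S : Set (Set α)) : Prop :=
  ∀ C : Set (Set α), IsClubOfCountable X C → (S ∩ C).Nonempty

end Clubs

/-! ### The structures `H(θ)` and elementarity -/

/-- `H(θ)`: the sets whose transitive closure has size `< θ`, i.e. the sets which are included in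
a transitive set of size `< θ`. -/
def H (θ : Cardinal.{u}) : Set ZFSet.{u} :=
  {x | ∃ t : ZFSet.{u}, t.IsTransitive ∧ x ⊆ t ∧ t.card < θ}

/-- The only symbol of the language of set theory. -/
inductive SetRel : ℕ → Type
  | mem : SetRel 2

/-- The language of set theory. -/
def setLang : FirstOrder.Language := ⟨fun _ => Empty, SetRel⟩

/-- Every class of sets is a structure for the language of set theory, with the true `∈`. -/
instance setStructure (X : Set ZFSet.{u}) : setLang.Structure X where
  funMap := fun f => f.elim
  RelMap := fun {_} r => match r with
    | SetRel.mem => fun v => (v 0 : ZFSet.{u}) ∈ (v 1 : ZFSet.{u})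

/-- `N ≺ H(θ)`. -/
def IsElemSubmodel (θ : Cardinal.{u}) (N : Set ZFSet.{u}) : Prop :=
  ∃ S : setLang.ElementarySubstructure (H θ), N = Subtype.val '' (S : Set (H θ))

/-! ### Forcing posets, names and the forcing relation -/

/-- A forcing poset in the universe of sets: a set of conditions with a reflexive and transitive
relation which has a largest element. `le q p` says that `q` is an extension of `p`. -/
structure ForcingPoset where
  carrier : ZFSet.{u}
  le : ZFSet.{u} → ZFSet.{u} → Prop
  le_refl : ∀ p ∈ carrier, le p p
  le_trans : ∀ p ∈ carrier, ∀ q ∈ carrier, ∀ r ∈ carrier, le p q → le q r → le p r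
  top : ZFSet.{u}
  top_mem : top ∈ carrier
  le_top : ∀ p ∈ carrier, le p top

namespace ForcingPoset

variable (Q : ForcingPoset.{u})

/-- The type of conditions. -/
def Cond : Type (u + 1) := {p : ZFSet.{u} // p ∈ Q.carrier}

instance : Preorder Q.Cond where
  le p q := Q.le p.1 q.1
  le_refl p := Q.le_refl p.1 p.2
  le_trans p q r := Q.le_trans p.1 p.2 q.1 q.2 r.1 r.2

instance : OrderTop Q.Cond where
  top := ⟨Q.top, Q.top_mem⟩
  le_top p := Q.le_top p.1 p.2

/-- `p` and `q` have a common extension. -/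
def Compatible (p q : ZFSet.{u}) : Prop :=
  ∃ r ∈ Q.carrier, Q.le r p ∧ Q.le r q

/-- `D` is a dense subset of the poset `N ∩ Q`. -/
def IsDenseIn (N D : Set ZFSet.{u}) : Prop :=
  D ⊆ N ∩ Q.carrier ∧ ∀ p ∈ N ∩ Q.carrier, ∃ d ∈ D, Q.le d p

/-- `D` is predense in `Q` below `q`. -/
def IsPredenseBelow (D : Set ZFSet.{u}) (q : ZFSet.{u}) : Prop :=
  ∀ r ∈ Q.carrier, Q.le r q → ∃ d ∈ D, Q.Compatible d r

/-- `q` is a strongly `(N, Q)`-generic condition. -/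
def IsStronglyGeneric (N : Set ZFSet.{u}) (q : ZFSet.{u}) : Prop :=
  q ∈ Q.carrier ∧ ∀ D : Set ZFSet.{u}, Q.IsDenseIn N D → Q.IsPredenseBelow D q

/-- `Q` is strongly proper on a stationary set: for all sufficiently large regular `θ` with
`Q ⊆ H(θ)` there are stationarily many countable `N ≺ H(θ)` such that every condition in `N ∩ Q`
has a strongly `(N, Q)`-generic extension. -/
def IsStronglyProperOnStationary : Prop :=
  ∃ θ₀ : Cardinal.{u}, ∀ θ : Cardinal.{u}, θ₀ ≤ θ → θ.IsRegular →
    (Q.carrier : Set ZFSet.{u}) ⊆ H θ →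
    IsStationaryOfCountable (H θ)
      {N | N.Countable ∧ IsElemSubmodel θ N ∧
        ∀ p ∈ N ∩ Q.carrier, ∃ q, Q.le q p ∧ Q.IsStronglyGeneric N q}

end ForcingPoset

/-- Names over a poset `Q`: small sets of pairs (name, condition). -/
inductive Name (Q : Type v) : Type (max v (u + 1))
  | mk (ι : Type u) (name : ι → Name Q) (cond : ι → Q) : Name Q

namespace Name

variable {Q : Type v}

/-- `{x, y}` as a name. -/
def unordered [Preorder Q] [OrderTop Q] (x y : Name.{u} Q) : Name.{u} Q :=
  mk (ULift.{u} Bool) (fun b => if b.down then x else y) (fun _ => ⊤)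

/-- The canonical name for the ordered pair `(x, y) = {{x}, {x, y}}`. -/
def ordered [Preorder Q] [OrderTop Q] (x y : Name.{u} Q) : Name.{u} Q :=
  unordered (unordered x x) (unordered x y)

/-- The canonical name `x̌ = {(y̌, 1) : y ∈ x}` of a set `x` of the ground model. -/
noncomputable def check [Preorder Q] [OrderTop Q] (x : ZFSet.{u}) : Name.{u} Q :=
  mk (Shrink.{u} x) (fun i => check ((equivShrink x).symm i : ZFSet.{u})) (fun _ => ⊤)
termination_by x
decreasing_by exact ((equivShrink x).symm i).2

end Name

/-! A statement of the forcing language over `Q` is given by the set of conditions which force it,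
so `φ p` reads `p ⊩ φ`. -/

section Forces

variable {Q : Type v} [Preorder Q]

/-- `p ⊩ x = y`: for every `(z, r) ∈ x` the conditions forcing `z ∈ y` are dense below every
`q ≤ p, r`, and the same with `x` and `y` exchanged. -/
def fEq : Name.{u} Q → Name.{u} Q → Q → Prop
  | .mk ι A c, .mk κ B d => fun p =>
    (∀ i : ι, ∀ q ≤ p, q ≤ c i → ∃ s ≤ q, ∃ j : κ, s ≤ d j ∧ fEq (A i) (B j) s) ∧
    (∀ j : κ, ∀ q ≤ p, q ≤ d j → ∃ s ≤ q, ∃ i : ι, s ≤ c i ∧ fEq (A i) (B j) s)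

/-- `p ⊩ x ∈ y`: densely many `s` below `p` lie below some `r` with `(z, r) ∈ y` and
`s ⊩ x = z`. -/
def fMem (x : Name.{u} Q) : Name.{u} Q → Q → Prop
  | .mk κ B d => fun p => ∀ q ≤ p, ∃ s ≤ q, ∃ j : κ, s ≤ d j ∧ fEq x (B j) s

/-- Negation. -/
def fNot (φ : Q → Prop) : Q → Prop := fun p => ∀ q ≤ p, ¬ φ q

/-- Conjunction. -/
def fAnd (φ ψ : Q → Prop) : Q → Prop := fun p => φ p ∧ ψ p

/-- Implication. -/
def fImp (φ ψ : Q → Prop) : Q → Prop := fun p => ∀ q ≤ p, φ q → ψ q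

/-- Universal quantification over names. -/
def fAll (φ : Name.{u} Q → Q → Prop) : Q → Prop := fun p => ∀ x, φ x p

/-- Existential quantification over names. -/
def fEx (φ : Name.{u} Q → Q → Prop) : Q → Prop := fun p => ∀ q ≤ p, ∃ s ≤ q, ∃ x, φ x s

/-- Bounded universal quantification. -/
def fAllIn (a : Name.{u} Q) (φ : Name.{u} Q → Q → Prop) : Q → Prop :=
  fAll fun x => fImp (fMem x a) (φ x)

/-- Bounded existential quantification. -/
def fExIn (a : Name.{u} Q) (φ : Name.{u} Q → Q → Prop) : Q → Prop :=
  fEx fun x => fAnd (fMem x a) (φ x)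

variable [OrderTop Q]

/-- "`f` is a function from `a` onto `b`". -/
def fSurjection (f a b : Name.{u} Q) : Q → Prop :=
  fAnd (fAllIn f fun z => fExIn a fun x => fExIn b fun y => fEq z (.ordered x y)) <|
  fAnd (fAllIn a fun x => fExIn b fun y => fMem (.ordered x y) f) <|
  fAnd (fAllIn a fun x => fAllIn b fun y => fAllIn b fun y' =>
    fImp (fAnd (fMem (.ordered x y) f) (fMem (.ordered x y') f)) (fEq y y')) <|
  fAllIn b fun y => fExIn a fun x => fMem (.ordered x y) f

/-- For a name `κ` of an ordinal: "`κ` is a cardinal", i.e. no `a ∈ κ` is mapped onto `κ` by a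
function. -/
def fIsCardinal (κ : Name.{u} Q) : Q → Prop :=
  fNot <| fExIn κ fun a => fEx fun f => fSurjection f a κ

end Forces

/-- `Q` preserves the cardinal `κ` (given as an initial ordinal): every condition forces that `κ`
is a cardinal. -/
def ForcingPoset.PreservesCardinal (Q : ForcingPoset.{u}) (κ : Ordinal.{u}) : Prop :=
  ∀ p : Q.Cond, fIsCardinal (Name.check.{u} κ.toZFSet) p

/-! ### Models

Ordinals are identified with von Neumann ordinals through `Ordinal.toZFSet`. In this part
`π : ω₂ → H(ω₂)` is the fixed bijection (only its values below `ω₂` matter) and `Y` is the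
fixed thin stationary set. -/

/-- The set of ordinals which belong to `M`. -/
def ordsOf (M : Set ZFSet.{u}) : Set Ordinal.{u} := {α | α.toZFSet ∈ M}

/-- The symbols of the language of `(H(ω₂), ∈, π, Y)`. -/
inductive ModelRel : ℕ → Type
  | mem : ModelRel 2
  | enum : ModelRel 2
  | side : ModelRel 1

/-- The language of `(H(ω₂), ∈, π, Y)`. -/
def modelLang : FirstOrder.Language := ⟨fun _ => Empty, ModelRel⟩

/-- The structure `𝒜 = (H(ω₂), ∈, π, Y)`; the function `π` is a binary relation on `H(ω₂)`. -/
@[reducible]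
def modelStructure (π : Ordinal.{u} → ZFSet.{u}) (Y : ZFSet.{u}) :
    modelLang.Structure (H.{u} (ℵ_ 2)) where
  funMap := fun f => f.elim
  RelMap := fun {_} r => match r with
    | ModelRel.mem => fun v => (v 0 : ZFSet.{u}) ∈ (v 1 : ZFSet.{u})
    | ModelRel.enum => fun v => ∃ α < ω_ 2, α.toZFSet = (v 0 : ZFSet.{u}) ∧ π α = (v 1 : ZFSet.{u})
    | ModelRel.side => fun v => (v 0 : ZFSet.{u}) ∈ Y

/-- `𝒜 ⊨ φ[x, v]`. -/
def Sat (π : Ordinal.{u} → ZFSet.{u}) (Y : ZFSet.{u}) {n : ℕ} (φ : modelLang.Formula (Fin (n + 1)))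
    (x : H.{u} (ℵ_ 2)) (v : Fin n → H.{u} (ℵ_ 2)) : Prop :=
  @FirstOrder.Language.Formula.Realize modelLang _ (modelStructure π Y) _ φ
    (Fin.cons x v : Fin (n + 1) → H.{u} (ℵ_ 2))

/-- `x = f_φ(v)`, where `f_φ` is the definable Skolem function of `𝒜` which picks the first
witness of `φ(·, v)` in the well-ordering of `H(ω₂)` induced by `π`. -/
def IsSkolemValue (π : Ordinal.{u} → ZFSet.{u}) (Y : ZFSet.{u}) {n : ℕ}
    (φ : modelLang.Formula (Fin (n + 1))) (v : Fin n → H.{u} (ℵ_ 2)) (x : H.{u} (ℵ_ 2)) : Prop :=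
  Sat π Y φ x v ∧ ∃ α < ω_ 2, π α = x ∧
    ∀ β < α, ∀ y : H.{u} (ℵ_ 2), π β = y → ¬ Sat π Y φ y v

/-- Membership in the closure of `a` under the definable Skolem functions. -/
inductive InSk (π : Ordinal.{u} → ZFSet.{u}) (Y : ZFSet.{u}) (a : Set ZFSet.{u}) :
    H.{u} (ℵ_ 2) → Prop
  | base (x : H.{u} (ℵ_ 2)) (hx : (x : ZFSet.{u}) ∈ a) : InSk π Y a x
  | skolem {n : ℕ} (φ : modelLang.Formula (Fin (n + 1))) (v : Fin n → H.{u} (ℵ_ 2))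
      (x : H.{u} (ℵ_ 2)) (hv : ∀ i, InSk π Y a (v i)) (hx : IsSkolemValue π Y φ v x) : InSk π Y a x

/-- `Sk(a)`: the closure of `a ⊆ H(ω₂)` under the definable Skolem functions of `𝒜`. -/
def Sk (π : Ordinal.{u} → ZFSet.{u}) (Y : ZFSet.{u}) (a : Set ZFSet.{u}) : Set ZFSet.{u} :=
  Subtype.val '' {x | InSk π Y a x}

/-- `Sk(a) ∩ ω₂ = a`. -/
def SkClosed (π : Ordinal.{u} → ZFSet.{u}) (Y : ZFSet.{u}) (a : ZFSet.{u}) : Prop :=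
  Sk π Y a ∩ ((ω_ 2).toZFSet : ZFSet.{u}) = a

/-- `C`: the set of `β < ω₂` with `Sk(β) ∩ ω₂ = β`. -/
def clubC (π : Ordinal.{u} → ZFSet.{u}) (Y : ZFSet.{u}) : Set Ordinal.{u} :=
  {β | β < ω_ 2 ∧ SkClosed π Y β.toZFSet}

/-- `Λ`: the limit points of `C` below `ω₂` of cofinality `ω₁`. -/
def Lam (π : Ordinal.{u} → ZFSet.{u}) (Y : ZFSet.{u}) : Set Ordinal.{u} :=
  {β | β < ω_ 2 ∧ β.cof = ℵ_ 1 ∧ ∀ γ < β, ∃ δ ∈ clubC π Y, γ < δ ∧ δ < β}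

/-- `𝒳`: the set of `M ∈ Y` such that `Sk(M) ∩ ω₂ = M` and `sup (C ∩ γ) ∈ M` for all `γ ∈ M`. -/
noncomputable def models (π : Ordinal.{u} → ZFSet.{u}) (Y : ZFSet.{u}) : ZFSet.{u} :=
  Y.sep fun M => SkClosed π Y M ∧
    ∀ γ ∈ ordsOf M, sSup (clubC π Y ∩ Set.Iio γ) ∈ ordsOf M

/-- `Γ_M`: the set of `β ∈ Γ` with `β = min (Γ ∖ sup (M ∩ β))`. -/
noncomputable def gammaOf (Γ : Set Ordinal.{u}) (M : ZFSet.{u}) : Set Ordinal.{u} :=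
  {β | IsLeast {γ | γ ∈ Γ ∧ sSup (ordsOf M ∩ Set.Iio β) ≤ γ} β}

/-- The comparison point `β_{M,N}`, the largest element of `Γ_M ∩ Γ_N`. -/
noncomputable def cmpPoint (Γ : Set Ordinal.{u}) (M N : ZFSet.{u}) : Ordinal.{u} :=
  sSup (gammaOf Γ M ∩ gammaOf Γ N)

/-- A set `A ⊆ 𝒳` is adequate if for all `M, N ∈ A` either `M ∩ β_{M,N} = N ∩ β_{M,N}`, or
`M ∩ β_{M,N} ∈ Sk(N)`, or `N ∩ β_{M,N} ∈ Sk(M)`. -/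
def IsAdequate (π : Ordinal.{u} → ZFSet.{u}) (Y : ZFSet.{u}) (Γ : Set Ordinal.{u})
    (A : ZFSet.{u}) : Prop :=
  A ⊆ models π Y ∧ ∀ M ∈ A, ∀ N ∈ A,
    M ∩ (cmpPoint Γ M N).toZFSet = N ∩ (cmpPoint Γ M N).toZFSet ∨
    M ∩ (cmpPoint Γ M N).toZFSet ∈ Sk π Y N ∨
    N ∩ (cmpPoint Γ M N).toZFSet ∈ Sk π Y M

/-- The forcing poset of finite adequate sets, ordered by reverse inclusion. -/
noncomputable def adequatePoset (π : Ordinal.{u} → ZFSet.{u}) (Y : ZFSet.{u})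
    (Γ : Set Ordinal.{u}) : ForcingPoset.{u} where
  carrier := (models π Y).powerset.sep fun A =>
    (A : Set ZFSet.{u}).Finite ∧ IsAdequate π Y Γ A
  le B A := A ⊆ B
  le_refl _ _ := fun _ h => h
  le_trans _ _ _ _ _ _ h₁ h₂ := fun _ h => h₁ (h₂ h)
  top := ∅
  top_mem := by
    simp [IsAdequate]
  le_top _ _ := ZFSet.empty_subset _

/-- The function `π : ω₂ → H(ω₂)` as a set of ordered pairs. -/
noncomputable def graphOf (π : Ordinal.{u} → ZFSet.{u}) : ZFSet.{u} :=
  ZFSet.range fun α : Set.Iio (ω_ 2 : Ordinal.{u}) => ZFSet.pair α.1.toZFSet (π α)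

/-- `Y` is a thin stationary subset of `P_{ω₁}(ω₂)` which is closed under initial segments. -/
structure IsThinStationary (Y : ZFSet.{u}) : Prop where
  subset : ∀ a ∈ Y, a ⊆ (ω_ 2).toZFSet ∧ (a : Set ZFSet.{u}).Countable
  stationary : IsStationaryOfCountable ((ω_ 2).toZFSet : Set ZFSet.{u})
    {s | ∃ a ∈ Y, s = (a : Set ZFSet.{u})}
  thin : ∀ β : Ordinal.{u}, β < ω_ 2 →
    #{b : ZFSet.{u} // ∃ a ∈ Y, b = a ∩ β.toZFSet} ≤ ℵ_ 1
  initial : ∀ a ∈ Y, ∀ β : Ordinal.{u}, β < ω_ 2 → a ∩ β.toZFSet ∈ Y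

end AdequateForcing

/-! The core is an amalgamation over a single model. Let `N*` be elementary in `H(θ)` with trace `N
∈ 𝒳` on `ω₂`. Because `π ∈ N*`, the trace of `N*` on `H(ω₂)` is `π[N] = Sk(N)`
(`IsElemSubmodel.inter_H_eq`), so the conditions in `N*` are exactly those in `Sk(N)`. If `A` is one
of them, then all its models and their initial segments lie in `Sk(N)`, and `A ∪ {N}` is adequate.

Let `r` be any condition containing `N`. Project it to `p = {M ∩ β_{M,N} : M ∈ r, M ∩ β_{M,N} ∈
Sk(N)}`. Adequacy survives cutting models at points of `Γ` (`Comparable.inter_inter`), so `p` is a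
finite adequate subset of `Sk(N)`, hence an element of `N*`. If `d ∈ N*` extends `p`, then `d ∪ r`
is adequate: each `M ∈ r` is comparable with each `K ∈ d` (`Comparable.of_mem_Sk`), either because
`N ∩ β_{M,N} ⊆ M`, or because `M ∩ β_{M,N}` is already in `d`. Thus every dense subset of `N* ∩ ℙ`,
whether or not it is definable in `N*`, is predense below any condition containing `N`
(`isStronglyGeneric_of_mem`).

Two facts make the comparisons work. First, comparison points exist (`isGreatest_cmpPoint`) and can
only decrease when a model is replaced by a subset. Second, by thinness a set `b ∈ Y` included in
some `η ∈ Λ` has `π`-index below `η`, so `b ∈ Sk(M)` already implies `b ∈ Sk(M ∩ η)`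
(`exists_index_of_mem_Sk`).

Enough models exist because stationarity of `Y` in the countable subsets of `ω₂` lifts to `H(θ)`
(`IsStationaryOfCountable.exists_lift`, `exists_submodel`). For `ω₁`, a strongly generic condition
confines the values of a name for a function on a countable ordinal to a countable model, so the
function is not onto `ω₁` (`ForcingPoset.preservesCardinal_omega_one`). -/

namespace AdequateForcing

/-! ### Lifting stationary families of countable sets -/

section Lifting

variable {α : Type v}

/-- A recursively defined family with `tower c G e ⊇ e ∪ G e` which is monotone in `e`, where
`c b ⊇ b` for the countable sets `b` that are used. -/
noncomputable def tower (c : Set α → Set α) (G : Finset α → Set α) (e : Finset α) : Set α :=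
  c (↑e ∪ G e ∪ ⋃ e' : {e' : Finset α // e' ⊂ e}, tower c G e'.1)
termination_by e.card
decreasing_by exact Finset.card_lt_card e'.2

/-- Add to `b` the sets attached by `F` to the finite subsets of `b`. -/
def finStep (F : Finset α → Set α) (b : Set α) : Set α :=
  b ∪ ⋃ e : {e : Finset α // (e : Set α) ⊆ b}, F e.1

/-- The closure of `b` under `F`. -/
def finClosure (F : Finset α → Set α) (b : Set α) : Set α :=
  ⋃ n : ℕ, (finStep F)^[n] b

theorem subset_finStep (F : Finset α → Set α) (b : Set α) : b ⊆ finStep F b :=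
  Set.subset_union_left

theorem finStep_iterate_mono (F : Finset α → Set α) (b : Set α) :
    Monotone fun n : ℕ => (finStep F)^[n] b :=
  monotone_nat_of_le_succ fun n => by
    rw [Function.iterate_succ_apply']
    exact subset_finStep F _

theorem subset_finClosure (F : Finset α → Set α) (b : Set α) : b ⊆ finClosure F b :=
  Set.subset_iUnion (fun n : ℕ => (finStep F)^[n] b) 0

theorem exists_stage_of_monotone {f : ℕ → Set α} (hf : Monotone f) {e : Finset α}
    (he : (e : Set α) ⊆ ⋃ n, f n) : ∃ n, (e : Set α) ⊆ f n := by
  classical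
  induction e using Finset.induction_on with
  | empty => exact ⟨0, by simp⟩
  | insert a s _ ih =>
    rw [Finset.coe_insert, Set.insert_subset_iff] at he
    obtain ⟨n, hn⟩ := ih he.2
    obtain ⟨m, hm⟩ := Set.mem_iUnion.1 he.1
    refine ⟨max n m, ?_⟩
    rw [Finset.coe_insert, Set.insert_subset_iff]
    exact ⟨hf (le_max_right _ _) hm, hn.trans (hf (le_max_left _ _))⟩

theorem finClosure_closed (F : Finset α → Set α) (b : Set α) (e : Finset α)
    (he : (e : Set α) ⊆ finClosure F b) : F e ⊆ finClosure F b := by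
  obtain ⟨n, hn⟩ := exists_stage_of_monotone (finStep_iterate_mono F b) he
  refine fun x hx => Set.mem_iUnion.2 ⟨n + 1, ?_⟩
  rw [Function.iterate_succ_apply']
  exact Or.inr (Set.mem_iUnion.2 ⟨⟨e, hn⟩, hx⟩)

theorem finClosure_subset {F : Finset α → Set α} {a b : Set α} (hb : b ⊆ a)
    (ha : ∀ e : Finset α, (e : Set α) ⊆ a → F e ⊆ a) : finClosure F b ⊆ a := by
  refine Set.iUnion_subset fun n => ?_
  induction n with
  | zero => exact hb
  | succ n ih =>
    rw [Function.iterate_succ_apply']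
    refine Set.union_subset ih (Set.iUnion_subset fun e => ha _ (e.2.trans ih))

theorem finClosure_mono (F : Finset α → Set α) : Monotone (finClosure F) := fun _ b h =>
  finClosure_subset (h.trans (subset_finClosure F b)) (finClosure_closed F b)

theorem finClosure_countable {F : Finset α → Set α} {b : Set α} (hb : b.Countable)
    (hF : ∀ e : Finset α, (e : Set α) ⊆ finClosure F b → (F e).Countable) :
    (finClosure F b).Countable := by
  refine Set.countable_iUnion fun n => ?_
  induction n with
  | zero => exact hb
  | succ n ih =>
    have hsub : (finStep F)^[n] b ⊆ finClosure F b :=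
      Set.subset_iUnion (fun n : ℕ => (finStep F)^[n] b) n
    rw [Function.iterate_succ_apply']
    refine ih.union ?_
    have : Countable {e : Finset α // (e : Set α) ⊆ (finStep F)^[n] b} := by
      have h := (Set.countable_ofPred_finite_subset ih).preimage
        (f := fun e : Finset α => (e : Set α)) Finset.coe_injective
      exact (h.mono (s₁ := {e : Finset α | (e : Set α) ⊆ (finStep F)^[n] b})
        fun e he => And.intro e.finite_toSet he).to_subtype
    exact Set.countable_iUnion fun e => hF e.1 (e.2.trans hsub)

/-- `F` takes finite arguments, and a finite subset of an increasing union is already included in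
one stage. This continuity makes the sets closed under `F` a closed family. -/
theorem finClosure_iUnion (F : Finset α → Set α) {f : ℕ → Set α} (hf : Monotone f) :
    finClosure F (⋃ n, f n) = ⋃ n, finClosure F (f n) := by
  apply Set.Subset.antisymm
  · refine finClosure_subset (Set.iUnion_mono fun n => subset_finClosure F _) fun e he => ?_
    obtain ⟨n, hn⟩ := exists_stage_of_monotone ((finClosure_mono F).comp hf) he
    exact (finClosure_closed F _ e hn).trans
      (Set.subset_iUnion (fun n => finClosure F (f n)) n)
  · exact Set.iUnion_subset fun n => finClosure_mono F (Set.subset_iUnion f n)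

theorem exists_monotone_finset {s : Set α} (hs : s.Countable) :
    ∃ e : ℕ → Finset α, Monotone e ∧ ⋃ n, (e n : Set α) = s := by
  classical
  have := hs.to_subtype
  obtain ⟨f, hf⟩ := exists_injective_nat s
  refine ⟨fun n => ((Set.finite_Iio n).preimage hf.injOn).toFinset.image Subtype.val, ?_, ?_⟩
  · intro m n hmn
    refine Finset.image_subset_image fun x hx => ?_
    simp only [Set.Finite.mem_toFinset, Set.mem_preimage, Set.mem_Iio] at hx ⊢
    omega
  · ext x
    simp only [Finset.coe_image, Set.Finite.coe_toFinset, Set.mem_iUnion, Set.mem_image,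
      Set.mem_preimage, Set.mem_Iio, Subtype.exists, exists_and_right, exists_eq_right]
    exact ⟨fun ⟨_, h, _⟩ => h, fun h => ⟨f ⟨x, h⟩ + 1, h, Nat.lt_succ_self _⟩⟩

/-- If `S` is stationary in `P_{ω₁}(Z)` and `Z ⊆ X`, then every club of `P_{ω₁}(X)` has an element
whose trace on `Z` is in `S`, and which is closed under a given function on finite sets. -/
theorem IsStationaryOfCountable.exists_lift {Z X : Set α} {S C : Set (Set α)}
    (hS : IsStationaryOfCountable Z S) (hZX : Z ⊆ X) (hC : IsClubOfCountable X C)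
    (G : Finset α → Set α) (hG : ∀ e : Finset α, (e : Set α) ⊆ X → G e ⊆ X ∧ (G e).Countable) :
    ∃ N ∈ C, (∀ e : Finset α, (e : Set α) ⊆ N → G e ⊆ N) ∧ N ∩ Z ∈ S := by
  classical
  choose! c hcC hc using fun (b : Set α) (h : b ⊆ X ∧ b.Countable) => hC.cofinal b h.1 h.2
  set F := tower c G with hF
  -- `F` is built to be monotone with values in the club, so that a set closed under `F` is an
  -- increasing union of club elements.
  have hFeq : ∀ e, F e = c (↑e ∪ G e ∪ ⋃ e' : {e' : Finset α // e' ⊂ e}, F e'.1) := fun e => by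
    rw [hF, tower]
  have key : ∀ n : ℕ, ∀ e : Finset α, e.card = n → (e : Set α) ⊆ X →
      F e ∈ C ∧ (↑e ∪ G e ∪ ⋃ e' : {e' : Finset α // e' ⊂ e}, F e'.1) ⊆ F e := by
    intro n
    induction n using Nat.strong_induction_on with
    | _ n ih =>
      intro e he heX
      have hprev : ∀ e' : {e' : Finset α // e' ⊂ e}, F e'.1 ∈ C := fun e' =>
        (ih _ (he ▸ Finset.card_lt_card e'.2) e'.1 rfl
          ((Finset.coe_subset.2 e'.2.subset).trans heX)).1
      have hcount : Countable {e' : Finset α // e' ⊂ e} :=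
        (e.powerset.finite_toSet.subset (t := {e' | e' ⊂ e}) fun e' h =>
          Finset.mem_coe.2 (Finset.mem_powerset.2 (Finset.ssubset_iff_subset_ne.1 h).1)
          ).countable.to_subtype
      have hok : (↑e ∪ G e ∪ ⋃ e' : {e' : Finset α // e' ⊂ e}, F e'.1) ⊆ X ∧
          (↑e ∪ G e ∪ ⋃ e' : {e' : Finset α // e' ⊂ e}, F e'.1).Countable := by
        refine ⟨Set.union_subset (Set.union_subset heX (hG e heX).1)
          (Set.iUnion_subset fun e' => (hC.subset _ (hprev e')).1), ?_⟩
        exact (e.countable_toSet.union (hG e heX).2).union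
          (Set.countable_iUnion fun e' => (hC.subset _ (hprev e')).2)
      exact ⟨hFeq e ▸ hcC _ hok, (hc _ hok).trans (hFeq e).ge⟩
  have hFC : ∀ e : Finset α, (e : Set α) ⊆ X → F e ∈ C := fun e he => (key _ e rfl he).1
  have heF : ∀ e : Finset α, (e : Set α) ⊆ X → (e : Set α) ⊆ F e := fun e he =>
    (Set.subset_union_left.trans Set.subset_union_left).trans (key _ e rfl he).2
  have hGF : ∀ e : Finset α, (e : Set α) ⊆ X → G e ⊆ F e := fun e he =>
    (Set.subset_union_right.trans Set.subset_union_left).trans (key _ e rfl he).2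
  have hFmono : ∀ e e' : Finset α, e ⊆ e' → (e' : Set α) ⊆ X → F e ⊆ F e' := by
    intro e e' hee' he'
    obtain rfl | hss := eq_or_ssubset_of_subset hee'
    · rfl
    · exact ((Set.subset_iUnion (fun e'' : {e'' : Finset α // e'' ⊂ e'} => F e''.1)
        ⟨e, hss⟩).trans Set.subset_union_right).trans (key _ e' rfl he').2
  have hclX : ∀ b ⊆ X, finClosure F b ⊆ X := fun b hb =>
    finClosure_subset hb fun e he => (hC.subset _ (hFC e he)).1
  have hclc : ∀ b ⊆ X, b.Countable → (finClosure F b).Countable := by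
    intro b hb hbc
    exact finClosure_countable hbc fun e he => (hC.subset _ (hFC e (he.trans (hclX b hb)))).2
  -- The traces on `Z` of `F`-closed sets contain a club of `Z`; stationarity of `S` then selects
  -- such a trace.
  have hD : IsClubOfCountable Z {b | b ⊆ Z ∧ b.Countable ∧ finClosure F b ∩ Z = b} := by
    refine ⟨fun a ha => ⟨ha.1, ha.2.1⟩, fun b hb hbc => ?_, fun f hf hfD => ?_⟩
    · refine ⟨finClosure F b ∩ Z, ⟨Set.inter_subset_right,
        (hclc b (hb.trans hZX) hbc).mono Set.inter_subset_left, ?_⟩,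
        Set.subset_inter (subset_finClosure F b) hb⟩
      apply Set.Subset.antisymm
      · exact Set.inter_subset_inter_left _
          (finClosure_subset Set.inter_subset_left (finClosure_closed F b))
      · exact Set.subset_inter (subset_finClosure F _) Set.inter_subset_right
    · refine ⟨Set.iUnion_subset fun n => (hfD n).1, Set.countable_iUnion fun n => (hfD n).2.1, ?_⟩
      rw [finClosure_iUnion F hf, Set.iUnion_inter]
      exact Set.iUnion_congr fun n => (hfD n).2.2
  obtain ⟨b, hbS, hbZ, hbc, hb⟩ := hS _ hD
  have hbX := hbZ.trans hZX
  have hNX := hclX b hbX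
  refine ⟨finClosure F b, ?_, fun e he => (hGF e (he.trans hNX)).trans
    (finClosure_closed F b e he), by rwa [hb]⟩
  obtain ⟨e, he, heN⟩ := exists_monotone_finset (hclc b hbX hbc)
  have heN' : ∀ n, (e n : Set α) ⊆ finClosure F b := fun n =>
    (Set.subset_iUnion (fun n => (e n : Set α)) n).trans heN.le
  -- A countable `F`-closed set is exhausted by finite sets `e n`, and `e n ⊆ F (e n)`; monotonicity
  -- of `F` turns this into a chain in `C`.
  have : finClosure F b = ⋃ n, F (e n) := by
    apply Set.Subset.antisymm
    · rw [← heN]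
      exact Set.iUnion_mono fun n => heF _ ((heN' n).trans hNX)
    · exact Set.iUnion_subset fun n => finClosure_closed F b _ (heN' n)
  rw [this]
  exact hC.closed _ (fun m n hmn => hFmono _ _ (he hmn) ((heN' n).trans hNX))
    fun n => hFC _ ((heN' n).trans hNX)

end Lifting

/-- Final segments are club. Unboundedness is all that the argument needs from the stationarity of
`Γ`. -/
theorem exists_ge_of_isStationary {ι : Type v} [LinearOrder ι] {s : Set ι}
    (hs : IsStationary s) (a : ι) : ∃ b ∈ s, a ≤ b := by
  have : IsClub (Set.Ici a) := by
    refine ⟨?_, fun b => ⟨max a b, le_max_left _ _, le_max_right _ _⟩⟩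
    intro d hd hne _ b hb
    obtain ⟨x, hx⟩ := hne
    exact (hd hx).trans (hb.1 hx)
  exact hs this

/-! ### Closure properties of `H(θ)` -/

section HTheta

variable {θ : Cardinal.{u}} {x y : ZFSet.{u}}

theorem H.mem_trans (hx : x ∈ H θ) (hy : y ∈ x) : y ∈ H θ := by
  obtain ⟨t, ht, hxt, hc⟩ := hx
  exact ⟨t, ht, ht.subset_of_mem (hxt hy), hc⟩

theorem H.subset (hx : x ∈ H θ) (hy : y ⊆ x) : y ∈ H θ := by
  obtain ⟨t, ht, hxt, hc⟩ := hx
  exact ⟨t, ht, fun _ h => hxt (hy h), hc⟩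

theorem H_mono {κ : Cardinal.{u}} (h : θ ≤ κ) : H θ ⊆ H κ := fun _ ⟨t, ht, hxt, hc⟩ =>
  ⟨t, ht, hxt, hc.trans_le h⟩

/-- The union of `x` with chosen small transitive sets around its elements is transitive, and
regularity of `θ` keeps it small. -/
theorem H.of_forall_mem (hθ : θ.IsRegular) (hc : x.card < θ) (h : ∀ y ∈ x, y ∈ H θ) :
    x ∈ H θ := by
  choose! t ht hyt htc using h
  let f : Shrink.{u} x → ZFSet.{u} := fun i => t ((equivShrink x).symm i : ZFSet.{u})
  have hf : ∀ i, ((equivShrink x).symm i : ZFSet.{u}) ∈ x := fun i => ((equivShrink x).symm i).2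
  refine ⟨x ∪ ZFSet.iUnion f, ?_, ?_, ?_⟩
  · intro y hy z hz
    rw [ZFSet.mem_union] at hy ⊢
    right
    rcases hy with hy | hy
    · refine ZFSet.mem_iUnion.2 ⟨equivShrink x ⟨y, hy⟩, ?_⟩
      simpa [f] using hyt y hy hz
    · obtain ⟨i, hi⟩ := ZFSet.mem_iUnion.1 hy
      exact ZFSet.mem_iUnion.2 ⟨i, (ht _ (hf i)).subset_of_mem hi hz⟩
  · exact fun z hz => ZFSet.mem_union.2 (Or.inl hz)
  · refine ZFSet.card_union_le.trans_lt (add_lt_of_lt hθ.aleph0_le hc ?_)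
    have h1 := ZFSet.lift_card_iUnion_le_sum_card (f := f)
    rw [Cardinal.lift_id'] at h1
    exact h1.trans_lt (sum_lt_of_isRegular hθ hc fun i => htc _ (hf i))

theorem H.insert (hθ : θ.IsRegular) (hx : x ∈ H θ) (hy : y ∈ H θ) : insert x y ∈ H θ := by
  have hyc : y.card < θ := by
    obtain ⟨t, _, hyt, hc⟩ := hy
    exact (ZFSet.card_mono hyt).trans_lt hc
  refine .of_forall_mem hθ (ZFSet.card_insert_le.trans_lt ?_) fun z hz => ?_
  · exact add_lt_of_lt hθ.aleph0_le hyc (one_lt_aleph0.trans_le hθ.aleph0_le)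
  · rcases ZFSet.mem_insert_iff.1 hz with rfl | hz
    · exact hx
    · exact H.mem_trans hy hz

theorem H.empty (hθ : θ.IsRegular) : (∅ : ZFSet.{u}) ∈ H θ :=
  .of_forall_mem hθ (by simpa using hθ.pos) fun _ h => absurd h (ZFSet.notMem_empty _)

theorem H.pair (hθ : θ.IsRegular) (hx : x ∈ H θ) (hy : y ∈ H θ) : ZFSet.pair x y ∈ H θ := by
  have h : ∀ z ∈ H θ, ({z} : ZFSet.{u}) ∈ H θ := fun z hz => by
    simpa using H.insert hθ hz (H.empty hθ)
  exact H.insert hθ (h _ hx) (h _ (H.insert hθ hx (h _ hy)))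

theorem toZFSet_mem_H {α : Ordinal.{u}} (h : α.card < θ) : α.toZFSet ∈ H θ :=
  ⟨α.toZFSet, (ZFSet.isOrdinal_toZFSet α).isTransitive, fun _ h => h,
    by rwa [Ordinal.card_toZFSet]⟩

theorem mem_toZFSet_H {α : Ordinal.{u}} (h : α < ω_ 2) : α.toZFSet ∈ H (ℵ_ 2 : Cardinal.{u}) :=
  toZFSet_mem_H (lt_omega_iff_card_lt.1 h)

theorem isRegular_aleph_two : (ℵ_ 2 : Cardinal.{u}).IsRegular := by
  have := isRegular_aleph_add_one.{u} 1
  rwa [one_add_one_eq_two] at this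

theorem card_lt_of_countable (hx : (x : Set ZFSet.{u}).Countable) (hθ : ℵ₀ < θ) :
    x.card < θ := by
  refine lt_of_le_of_lt ?_ hθ
  rw [← Cardinal.lift_le.{u + 1}, ← ZFSet.cardinalMk_coe_sort, lift_aleph0]
  exact Set.countable_coe_iff.2 hx |>.casesOn fun h => mk_le_aleph0_iff.2 ⟨h⟩

theorem aleph0_lt_aleph_two : ℵ₀ < (ℵ_ 2 : Cardinal.{u}) := by
  rw [← aleph_zero]
  exact aleph_lt_aleph.2 zero_lt_two

end HTheta

/-! ### Definability in classes of sets -/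

section Definability

open FirstOrder

/-- `P` is definable without parameters. -/
def IsDef (L : Language) {M : Type v} [L.Structure M] {ι : Type} (P : (ι → M) → Prop) : Prop :=
  ∃ φ : L.Formula ι, ∀ v, φ.Realize v ↔ P v

namespace IsDef

variable {L : Language} {M : Type v} [L.Structure M] {ι κ : Type}

theorem congr {P Q : (ι → M) → Prop} (hP : IsDef L P) (h : ∀ v, P v ↔ Q v) : IsDef L Q :=
  let ⟨φ, hφ⟩ := hP
  ⟨φ, fun v => (hφ v).trans (h v)⟩

theorem not {P : (ι → M) → Prop} (hP : IsDef L P) : IsDef L fun v => ¬ P v :=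
  let ⟨φ, hφ⟩ := hP
  ⟨φ.not, fun v => by rw [Language.Formula.realize_not, hφ]⟩

theorem imp {P Q : (ι → M) → Prop} (hP : IsDef L P) (hQ : IsDef L Q) :
    IsDef L fun v => P v → Q v :=
  let ⟨φ, hφ⟩ := hP
  let ⟨ψ, hψ⟩ := hQ
  ⟨φ.imp ψ, fun v => by rw [Language.Formula.realize_imp, hφ, hψ]⟩

theorem and {P Q : (ι → M) → Prop} (hP : IsDef L P) (hQ : IsDef L Q) :
    IsDef L fun v => P v ∧ Q v :=
  (hP.imp hQ.not).not.congr fun v => by tauto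

theorem or {P Q : (ι → M) → Prop} (hP : IsDef L P) (hQ : IsDef L Q) :
    IsDef L fun v => P v ∨ Q v :=
  (hP.not.imp hQ).congr fun v => by tauto

theorem iff {P Q : (ι → M) → Prop} (hP : IsDef L P) (hQ : IsDef L Q) :
    IsDef L fun v => (P v ↔ Q v) :=
  ((hP.imp hQ).and (hQ.imp hP)).congr fun v => by tauto

theorem ex {P : (ι → M) → M → Prop}
    (hP : IsDef L fun w : Option ι → M => P (fun i => w (some i)) (w none)) :
    IsDef L fun v => ∃ x, P v x := by
  obtain ⟨φ, hφ⟩ := hP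
  refine ⟨(φ.relabel (fun o : Option ι => o.elim (Sum.inr ()) Sum.inl) :
    L.Formula (ι ⊕ Unit)).iExs Unit, fun v => ?_⟩
  rw [Language.Formula.realize_iExs]
  constructor
  · rintro ⟨i, hi⟩
    rw [Language.Formula.realize_relabel, hφ] at hi
    exact ⟨_, hi⟩
  · rintro ⟨x, hx⟩
    refine ⟨fun _ => x, ?_⟩
    rw [Language.Formula.realize_relabel, hφ]
    exact hx

theorem all {P : (ι → M) → M → Prop}
    (hP : IsDef L fun w : Option ι → M => P (fun i => w (some i)) (w none)) :
    IsDef L fun v => ∀ x, P v x :=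
  (ex (P := fun v x => ¬ P v x) hP.not).not.congr fun v => by simp

theorem rel₂ (R : L.Relations 2) (i j : ι) :
    IsDef L fun v : ι → M => Language.Structure.RelMap R ![v i, v j] :=
  ⟨R.formula₂ (.var i) (.var j), fun v => by
    rw [Language.Formula.realize_rel₂]; rfl⟩

theorem rel₁ (R : L.Relations 1) (i : ι) :
    IsDef L fun v : ι → M => Language.Structure.RelMap R ![v i] :=
  ⟨R.formula₁ (.var i), fun v => by
    rw [Language.Formula.realize_rel₁]; rfl⟩

end IsDef

/-- `X` is a transitive class, and membership is definable in the structure on `X`. -/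
structure IsSetModel (L : Language) (X : Set ZFSet.{u}) [L.Structure X] : Prop where
  trans : ∀ x ∈ X, ∀ y ∈ x, y ∈ X
  mem : ∀ {ι : Type} (i j : ι), IsDef L fun v : ι → X => (v i : ZFSet.{u}) ∈ (v j : ZFSet.{u})

namespace IsSetModel

variable {L : Language} {X : Set ZFSet.{u}} [L.Structure X] {ι : Type}

/-- Extensionality in a transitive class: to define equality with a set operation it suffices to
define membership in its value, provided that the elements of the value stay in the class. -/
theorem eq_term (h : IsSetModel L X) (k : ι) {t : (ι → X) → ZFSet.{u}}
    (ht : ∀ v, ∀ z ∈ t v, z ∈ X)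
    (hd : IsDef L fun w : Option ι → X => (w none : ZFSet.{u}) ∈ t fun i => w (some i)) :
    IsDef L fun v : ι → X => (v k : ZFSet.{u}) = t v := by
  refine (IsDef.all (P := fun (v : ι → X) (x : X) => (x : ZFSet.{u}) ∈ (v k : ZFSet.{u}) ↔ (x : ZFSet.{u}) ∈ t v)
    ((h.mem none (some k)).iff hd)).congr fun v => ⟨fun hv => ?_, fun hv x => by rw [hv]⟩
  ext z
  exact ⟨fun hz => (hv ⟨z, h.trans _ (v k).2 _ hz⟩).1 hz, fun hz => (hv ⟨z, ht v z hz⟩).2 hz⟩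

theorem subset (h : IsSetModel L X) (i j : ι) :
    IsDef L fun v : ι → X => (v i : ZFSet.{u}) ⊆ (v j : ZFSet.{u}) :=
  (IsDef.all (P := fun (v : ι → X) (x : X) => (x : ZFSet.{u}) ∈ (v i : ZFSet.{u}) → (x : ZFSet.{u}) ∈ (v j).1)
    ((h.mem none (some i)).imp (h.mem none (some j)))).congr fun v =>
      ⟨fun hv z hz => hv ⟨z, h.trans _ (v i).2 _ hz⟩ hz, fun hv _ hx => hv hx⟩

theorem eq (h : IsSetModel L X) (i j : ι) :
    IsDef L fun v : ι → X => (v i : ZFSet.{u}) = (v j : ZFSet.{u}) :=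
  h.eq_term i (fun v _ hz => h.trans _ (v j).2 _ hz) (h.mem none (some j))

theorem empty (h : IsSetModel L X) (k : ι) :
    IsDef L fun v : ι → X => (v k : ZFSet.{u}) = ∅ :=
  h.eq_term k (fun v _ hz => absurd hz (ZFSet.notMem_empty _))
    (((h.mem none none).and (h.mem none none).not).congr fun v => by simp)

theorem insert (h : IsSetModel L X) (k i j : ι) :
    IsDef L fun v : ι → X => (v k : ZFSet.{u}) = insert (v i : ZFSet.{u}) (v j : ZFSet.{u}) := by
  refine h.eq_term k (fun v z hz => ?_) (((h.eq none (some i)).or (h.mem none (some j))).congr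
    fun v => by simp)
  rcases ZFSet.mem_insert_iff.1 hz with rfl | hz
  · exact (v i).2
  · exact h.trans _ (v j).2 _ hz

theorem inter (h : IsSetModel L X) (k i j : ι) :
    IsDef L fun v : ι → X => (v k : ZFSet.{u}) = (v i : ZFSet.{u}) ∩ (v j : ZFSet.{u}) :=
  h.eq_term k (fun v z hz => h.trans _ (v i).2 _ (ZFSet.mem_inter.1 hz).1)
    (((h.mem none (some i)).and (h.mem none (some j))).congr fun v => by simp)

theorem unordered (h : IsSetModel L X) (k i j : ι) :
    IsDef L fun v : ι → X => (v k : ZFSet.{u}) = {(v i : ZFSet.{u}), (v j : ZFSet.{u})} := by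
  refine h.eq_term k (fun v z hz => ?_) (((h.eq none (some i)).or (h.eq none (some j))).congr
    fun v => by simp)
  rcases ZFSet.mem_pair.1 hz with rfl | rfl
  · exact (v i).2
  · exact (v j).2

/-- The intermediate sets `{x}` and `{x, y}` of the Kuratowski pair can be quantified over in `X`,
since they are elements of the pair and `X` is transitive. -/
theorem pair (h : IsSetModel L X) (k i j : ι) : IsDef L fun v : ι → X =>
    (v k : ZFSet.{u}) = ZFSet.pair (v i : ZFSet.{u}) (v j : ZFSet.{u}) := by
  refine (IsDef.ex (P := fun (v : ι → X) (a : X) => ∃ b : X, (a : ZFSet.{u}) = {(v i).1, (v i).1} ∧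
    (b : ZFSet.{u}) = {(v i).1, (v j).1} ∧ (v k).1 = {a.1, b.1}) (IsDef.ex ?_)).congr fun v => ?_
  · exact (h.unordered (some none) (some (some i)) (some (some i))).and
      ((h.unordered none (some (some i)) (some (some j))).and
        (h.unordered (some (some k)) (some none) none))
  · constructor
    · rintro ⟨a, b, ha, hb, hk⟩
      rw [hk, ha, hb, ZFSet.pair, ZFSet.pair_eq_singleton]
    · intro hk
      have hm : ∀ z ∈ ZFSet.pair (v i).1 (v j).1, z ∈ X := fun z hz =>
        h.trans _ (v k).2 _ (hk ▸ hz)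
      refine ⟨⟨{(v i).1}, hm _ (by simp [ZFSet.pair])⟩,
        ⟨{(v i).1, (v j).1}, hm _ (by simp [ZFSet.pair])⟩, ?_, rfl, hk⟩
      simp

theorem pair_mem (h : IsSetModel L X) (k i j : ι) : IsDef L fun v : ι → X =>
    ZFSet.pair (v i : ZFSet.{u}) (v j : ZFSet.{u}) ∈ (v k : ZFSet.{u}) :=
  (IsDef.ex (P := fun (v : ι → X) (p : X) => (p : ZFSet.{u}) = ZFSet.pair (v i).1 (v j).1 ∧ p.1 ∈ (v k).1)
    ((h.pair none (some i) (some j)).and (h.mem none (some k)))).congr fun v =>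
      ⟨fun ⟨_, hp, hpk⟩ => hp ▸ hpk, fun hp => ⟨⟨_, h.trans _ (v k).2 _ hp⟩, rfl, hp⟩⟩

end IsSetModel

theorem isSetModel_setLang (θ : Cardinal.{u}) : IsSetModel setLang (H θ) where
  trans _ hx _ hy := H.mem_trans hx hy
  mem i j := IsDef.rel₂ (L := setLang) SetRel.mem i j

theorem isSetModel_modelLang (π : Ordinal.{u} → ZFSet.{u}) (Y : ZFSet.{u}) :
    @IsSetModel modelLang (H (ℵ_ 2)) (modelStructure π Y) :=
  letI := modelStructure π Y
  { trans := fun _ hx _ hy => H.mem_trans hx hy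
    mem := fun i j => IsDef.rel₂ (L := modelLang) ModelRel.mem i j }

theorem isDef_enum (π : Ordinal.{u} → ZFSet.{u}) (Y : ZFSet.{u}) {ι : Type} (i j : ι) :
    @IsDef modelLang (H (ℵ_ 2)) (modelStructure π Y) ι fun v =>
      ∃ α < ω_ 2, α.toZFSet = (v i : ZFSet.{u}) ∧ π α = (v j : ZFSet.{u}) :=
  letI := modelStructure π Y
  IsDef.rel₂ (L := modelLang) ModelRel.enum i j

theorem isDef_side (π : Ordinal.{u} → ZFSet.{u}) (Y : ZFSet.{u}) {ι : Type} (i : ι) :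
    @IsDef modelLang (H (ℵ_ 2)) (modelStructure π Y) ι fun v => (v i : ZFSet.{u}) ∈ Y :=
  letI := modelStructure π Y
  IsDef.rel₁ (L := modelLang) ModelRel.side i

/-- The Skolem hull meets every nonempty set definable from its elements. -/
theorem Sk.exists_of_isDef {π : Ordinal.{u} → ZFSet.{u}} {Y : ZFSet.{u}} {a : Set ZFSet.{u}}
    (hπ : Set.SurjOn π (Set.Iio (ω_ 2)) (H (ℵ_ 2))) {n : ℕ} {P : (Fin (n + 1) → H (ℵ_ 2)) → Prop}
    (hP : @IsDef modelLang (H (ℵ_ 2)) (modelStructure π Y) _ P) {v : Fin n → H (ℵ_ 2)}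
    (hv : ∀ i, (v i : ZFSet.{u}) ∈ Sk π Y a) (hx : ∃ x, P (Fin.cons x v)) :
    ∃ x : H (ℵ_ 2), (x : ZFSet.{u}) ∈ Sk π Y a ∧ P (Fin.cons x v) := by
  obtain ⟨φ, hφ⟩ := hP
  have hne : {α | α < ω_ 2 ∧ ∃ x : H.{u} (ℵ_ 2), π α = x ∧ P (Fin.cons x v)}.Nonempty := by
    obtain ⟨x, hx⟩ := hx
    obtain ⟨α, hα, hαx⟩ := hπ x.2
    exact ⟨α, hα, x, hαx, hx⟩
  obtain ⟨α, ⟨hα, x, hαx, hx⟩, hmin⟩ := WellFounded.has_min Ordinal.lt_wf _ hne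
  refine ⟨x, ⟨x, .skolem φ v x (fun i => ?_) ⟨(hφ _).2 hx, α, hα, hαx, ?_⟩, rfl⟩, hx⟩
  · obtain ⟨y, hy, hyv⟩ := hv i
    rwa [← Subtype.ext hyv]
  · exact fun β hβ y hy hs => hmin β ⟨hβ.trans hα, y, hy, (hφ _).1 hs⟩ hβ

/-- An elementary submodel meets every nonempty set definable from its elements. -/
theorem IsElemSubmodel.exists_of_isDef {θ : Cardinal.{u}} {N : Set ZFSet.{u}}
    (hN : IsElemSubmodel θ N) {n : ℕ} {P : (Fin (n + 1) → H θ) → Prop}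
    (hP : IsDef setLang P) {v : Fin n → H θ}
    (hv : ∀ i, (v i : ZFSet.{u}) ∈ N) (hx : ∃ x, P (Fin.cons x v)) :
    ∃ x : H θ, (x : ZFSet.{u}) ∈ N ∧ P (Fin.cons x v) := by
  obtain ⟨S, rfl⟩ := hN
  obtain ⟨φ, hφ⟩ := hP
  have hvS : ∀ i, v i ∈ S := fun i => by
    obtain ⟨y, hy, hyv⟩ := hv i
    rwa [← Subtype.ext hyv]
  let w : Fin n → S := fun i => ⟨v i, hvS i⟩
  let ψ : setLang.Formula (Fin n) :=
    (φ.relabel (Fin.cons (Sum.inr ()) Sum.inl : Fin (n + 1) → Fin n ⊕ Unit)).iExs Unit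
  have hψ : ψ.Realize v := by
    obtain ⟨x, hx⟩ := hx
    rw [Language.Formula.realize_iExs]
    refine ⟨fun _ => x, ?_⟩
    rw [Language.Formula.realize_relabel, hφ]
    convert hx using 1
    funext i
    refine Fin.cases ?_ (fun i => ?_) i <;> simp
  have hw : v = S.subtype ∘ w := rfl
  rw [hw, S.subtype.map_formula, Language.Formula.realize_iExs] at hψ
  obtain ⟨i, hi⟩ := hψ
  rw [Language.Formula.realize_relabel, ← S.subtype.map_formula, hφ] at hi
  refine ⟨i (), ⟨_, (i ()).2, rfl⟩, ?_⟩
  convert hi using 1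
  funext j
  refine Fin.cases ?_ (fun j => ?_) j
  · simp
  · simp [hw]

end Definability

/-! ### Skolem hulls -/

section Hull

variable {π : Ordinal.{u} → ZFSet.{u}} {Y : ZFSet.{u}} {a b : Set ZFSet.{u}}

theorem Sk_subset_H : Sk π Y a ⊆ H (ℵ_ 2) := by
  rintro _ ⟨x, _, rfl⟩
  exact x.2

theorem mem_Sk_of_mem {x : ZFSet.{u}} (hx : x ∈ a) (hH : x ∈ H (ℵ_ 2)) : x ∈ Sk π Y a :=
  ⟨⟨x, hH⟩, .base _ hx, rfl⟩

theorem Sk_mono (h : a ⊆ b) : Sk π Y a ⊆ Sk π Y b := by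
  rintro _ ⟨x, hx, rfl⟩
  refine ⟨x, ?_, rfl⟩
  change InSk π Y b x
  have hx' : InSk π Y a x := hx
  clear hx
  induction hx' with
  | base x hx => exact .base x (h hx)
  | skolem φ v x _ hx ih => exact .skolem φ v x ih hx

variable (hπ : Set.BijOn π (Set.Iio (ω_ 2)) (H (ℵ_ 2)))
include hπ

theorem Sk.exists₀ {P : H (ℵ_ 2) → Prop}
    (hP : @IsDef modelLang (H (ℵ_ 2)) (modelStructure π Y) (Fin 1) fun w => P (w 0))
    (hx : ∃ x, P x) : ∃ x : H (ℵ_ 2), (x : ZFSet.{u}) ∈ Sk π Y a ∧ P x :=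
  Sk.exists_of_isDef (v := Fin.elim0) hπ.surjOn hP (fun i => i.elim0) hx

theorem Sk.exists₁ {P : H (ℵ_ 2) → H (ℵ_ 2) → Prop}
    (hP : @IsDef modelLang (H (ℵ_ 2)) (modelStructure π Y) (Fin 2) fun w => P (w 0) (w 1))
    {y : H (ℵ_ 2)} (hy : (y : ZFSet.{u}) ∈ Sk π Y a) (hx : ∃ x, P x y) :
    ∃ x : H (ℵ_ 2), (x : ZFSet.{u}) ∈ Sk π Y a ∧ P x y :=
  Sk.exists_of_isDef (v := fun _ => y) hπ.surjOn hP (fun _ => hy) hx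

theorem Sk.exists₂ {P : H (ℵ_ 2) → H (ℵ_ 2) → H (ℵ_ 2) → Prop}
    (hP : @IsDef modelLang (H (ℵ_ 2)) (modelStructure π Y) (Fin 3) fun w => P (w 0) (w 1) (w 2))
    {y z : H (ℵ_ 2)} (hy : (y : ZFSet.{u}) ∈ Sk π Y a) (hz : (z : ZFSet.{u}) ∈ Sk π Y a)
    (hx : ∃ x, P x y z) : ∃ x : H (ℵ_ 2), (x : ZFSet.{u}) ∈ Sk π Y a ∧ P x y z :=
  Sk.exists_of_isDef (v := ![y, z]) hπ.surjOn hP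
    (fun i => by refine Fin.cases hy (fun i => ?_) i; simpa using hz) hx

theorem apply_mem_Sk {α : Ordinal.{u}} (hα : α < ω_ 2) (h : α.toZFSet ∈ Sk π Y a) :
    π α ∈ Sk π Y a := by
  obtain ⟨x, hx, β, hβ, hβα, hβx⟩ := Sk.exists₁ (a := a) (P := fun x y =>
    ∃ β < ω_ 2, β.toZFSet = (y : ZFSet.{u}) ∧ π β = (x : ZFSet.{u})) hπ (isDef_enum π Y 1 0)
    (y := ⟨α.toZFSet, mem_toZFSet_H hα⟩) h ⟨⟨π α, hπ.mapsTo hα⟩, α, hα, rfl, rfl⟩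
  rw [Ordinal.toZFSet_injective hβα] at hβx
  rwa [hβx]

theorem index_mem_Sk {α : Ordinal.{u}} (hα : α < ω_ 2) (h : π α ∈ Sk π Y a) :
    α.toZFSet ∈ Sk π Y a := by
  obtain ⟨x, hx, β, hβ, hβx, hβα⟩ := Sk.exists₁ (a := a) (P := fun x y =>
    ∃ β < ω_ 2, β.toZFSet = (x : ZFSet.{u}) ∧ π β = (y : ZFSet.{u})) hπ (isDef_enum π Y 0 1)
    (y := ⟨π α, hπ.mapsTo hα⟩) h ⟨⟨α.toZFSet, mem_toZFSet_H hα⟩, α, hα, rfl, rfl⟩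
  rw [← hβx] at hx
  rwa [hπ.injOn hβ hα hβα] at hx

omit hπ in
theorem SkClosed.mem_iff {N : ZFSet.{u}} (hN : SkClosed π Y N) {α : Ordinal.{u}} (hα : α < ω_ 2) :
    α.toZFSet ∈ Sk π Y N ↔ α.toZFSet ∈ N := by
  constructor
  · intro h
    have : α.toZFSet ∈ (N : Set ZFSet.{u}) := by
      rw [← hN]
      exact ⟨h, Ordinal.toZFSet_mem_toZFSet_iff.2 hα⟩
    exact this
  · intro h
    have : α.toZFSet ∈ (N : Set ZFSet.{u}) := h
    rw [← hN] at this
    exact this.1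

/-- The hull of a closed set of ordinals is its image under the enumeration. -/
theorem SkClosed.mem_Sk_iff {N : ZFSet.{u}} (hN : SkClosed π Y N) {x : ZFSet.{u}} :
    x ∈ Sk π Y N ↔ ∃ α < ω_ 2, α.toZFSet ∈ N ∧ π α = x := by
  constructor
  · intro h
    obtain ⟨α, hα, rfl⟩ := hπ.surjOn (Sk_subset_H h)
    exact ⟨α, hα, (hN.mem_iff hα).1 (index_mem_Sk hπ hα h), rfl⟩
  · rintro ⟨α, hα, hαN, rfl⟩
    exact apply_mem_Sk hπ hα ((hN.mem_iff hα).2 hαN)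

theorem apply_mem_Sk_of_mem {α : Ordinal.{u}} (hα : α < ω_ 2) (h : α.toZFSet ∈ a) :
    π α ∈ Sk π Y a :=
  apply_mem_Sk hπ hα (mem_Sk_of_mem h (mem_toZFSet_H hα))

theorem empty_mem_Sk : ∅ ∈ Sk π Y a := by
  let _ := modelStructure π Y
  obtain ⟨x, hx, h⟩ := Sk.exists₀ (a := a) (P := fun x => (x : ZFSet.{u}) = ∅) hπ
    ((isSetModel_modelLang π Y).empty 0) ⟨⟨∅, H.empty isRegular_aleph_two⟩, rfl⟩
  rwa [← h]

theorem insert_mem_Sk {x y : ZFSet.{u}} (hx : x ∈ Sk π Y a) (hy : y ∈ Sk π Y a) :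
    insert x y ∈ Sk π Y a := by
  let _ := modelStructure π Y
  obtain ⟨z, hz, h⟩ := Sk.exists₂ (a := a)
    (P := fun z x y => (z : ZFSet.{u}) = insert (x : ZFSet.{u}) (y : ZFSet.{u})) hπ
    ((isSetModel_modelLang π Y).insert 0 1 2) (y := ⟨x, Sk_subset_H hx⟩)
    (z := ⟨y, Sk_subset_H hy⟩) hx hy
    ⟨⟨_, H.insert isRegular_aleph_two (Sk_subset_H hx) (Sk_subset_H hy)⟩, rfl⟩
  rwa [← h]

theorem inter_mem_Sk {x y : ZFSet.{u}} (hx : x ∈ Sk π Y a) (hy : y ∈ Sk π Y a) :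
    x ∩ y ∈ Sk π Y a := by
  let _ := modelStructure π Y
  obtain ⟨z, hz, h⟩ := Sk.exists₂ (a := a)
    (P := fun z x y => (z : ZFSet.{u}) = (x : ZFSet.{u}) ∩ (y : ZFSet.{u})) hπ
    ((isSetModel_modelLang π Y).inter 0 1 2) (y := ⟨x, Sk_subset_H hx⟩)
    (z := ⟨y, Sk_subset_H hy⟩) hx hy
    ⟨⟨_, H.subset (Sk_subset_H hx) fun _ h => (ZFSet.mem_inter.1 h).1⟩, rfl⟩
  rwa [← h]

theorem mem_Sk_of_finite {x : ZFSet.{u}} (hfin : (x : Set ZFSet.{u}).Finite)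
    (hx : (x : Set ZFSet.{u}) ⊆ Sk π Y a) : x ∈ Sk π Y a := by
  have : ∀ s : Set ZFSet.{u}, s.Finite → s ⊆ Sk π Y a →
      ∃ y ∈ Sk π Y a, (y : Set ZFSet.{u}) = s := by
    intro s hs
    induction s, hs using Set.Finite.induction_on with
    | empty => exact fun _ => ⟨∅, empty_mem_Sk hπ, by simp⟩
    | @insert c s _ _ ih =>
      intro h
      obtain ⟨y, hy, rfl⟩ := ih ((Set.subset_insert _ _).trans h)
      exact ⟨insert c y, insert_mem_Sk hπ (h (Set.mem_insert _ _)) hy, by simp⟩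
  obtain ⟨y, hy, hyx⟩ := this _ hfin hx
  rwa [← SetLike.coe_injective hyx]

end Hull

/-- The closure of `{x₀}` under the relation `f` includes `x`. -/
def Sweeps (f x₀ x : H.{u} (ℵ_ 2)) : Prop :=
  ∀ z : H.{u} (ℵ_ 2), (x₀ : ZFSet.{u}) ∈ (z : ZFSet.{u}) →
    (∀ w w' : H.{u} (ℵ_ 2), (w : ZFSet.{u}) ∈ (z : ZFSet.{u}) →
      ZFSet.pair w w' ∈ (f : ZFSet.{u}) → (w' : ZFSet.{u}) ∈ (z : ZFSet.{u})) →
    (x : ZFSet.{u}) ⊆ (z : ZFSet.{u})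

/-- `f` is a functional relation. -/
def Functional (f : H.{u} (ℵ_ 2)) : Prop :=
  ∀ w w' w'' : H.{u} (ℵ_ 2), ZFSet.pair w w' ∈ (f : ZFSet.{u}) →
    ZFSet.pair w w'' ∈ (f : ZFSet.{u}) → (w' : ZFSet.{u}) = w''

/-- The relation sends each term of an enumeration to the next one. This expresses countability by
one relation and a starting point, with no reference to `ω` or to recursion inside the structure. -/
theorem exists_sweeps {x : ZFSet.{u}} (hxH : x ∈ H (ℵ_ 2)) (hx : (x : Set ZFSet.{u}).Countable) :
    ∃ f x₀ : H (ℵ_ 2), Functional f ∧ Sweeps f x₀ ⟨x, hxH⟩ := by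
  -- Adding the natural numbers makes the set infinite, so it has an enumeration without
  -- repetitions; injectivity is what makes the successor relation functional.
  set W : ZFSet.{u} := x ∪ ZFSet.range fun n : ℕ => ((n : Ordinal.{u})).toZFSet with hW
  have hWc : (W : Set ZFSet.{u}).Countable := by
    rw [hW, ZFSet.coe_union, ZFSet.coe_range]
    exact hx.union (Set.countable_range _)
  have hWi : (W : Set ZFSet.{u}).Infinite := by
    rw [hW, ZFSet.coe_union, ZFSet.coe_range]
    refine (Set.infinite_range_of_injective ?_).mono Set.subset_union_right
    exact Ordinal.toZFSet_injective.comp Nat.cast_injective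
  have hWH : ∀ w ∈ W, w ∈ H (ℵ_ 2) := by
    intro w hw
    rcases ZFSet.mem_union.1 hw with hw | hw
    · exact H.mem_trans hxH hw
    · obtain ⟨n, rfl⟩ := ZFSet.mem_range.1 hw
      refine toZFSet_mem_H ?_
      rw [Ordinal.card_nat]
      exact natCast_lt_aleph0.trans aleph0_lt_aleph_two
  obtain ⟨d⟩ := Set.countable_infinite_iff_nonempty_denumerable.1 ⟨hWc, hWi⟩
  let e : ℕ → ZFSet.{u} := fun n => ((Denumerable.eqv (W : Set ZFSet.{u})).symm n : ZFSet.{u})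
  have heH : ∀ n, e n ∈ H (ℵ_ 2) := fun n =>
    hWH _ ((Denumerable.eqv (W : Set ZFSet.{u})).symm n).2
  have hei : Function.Injective e :=
    Subtype.val_injective.comp (Denumerable.eqv (W : Set ZFSet.{u})).symm.injective
  have hes : ∀ w ∈ x, ∃ n, e n = w := fun w hw =>
    ⟨Denumerable.eqv (W : Set ZFSet.{u}) ⟨w, ZFSet.mem_union.2 (Or.inl hw)⟩, by simp [e]⟩
  have hfH : ZFSet.range (fun n => ZFSet.pair (e n) (e (n + 1))) ∈ H (ℵ_ 2) := by
    refine H.of_forall_mem isRegular_aleph_two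
      (card_lt_of_countable ?_ aleph0_lt_aleph_two) fun y hy => ?_
    · rw [ZFSet.coe_range]
      exact Set.countable_range _
    · obtain ⟨n, rfl⟩ := ZFSet.mem_range.1 hy
      exact H.pair isRegular_aleph_two (heH _) (heH _)
  refine ⟨⟨_, hfH⟩, ⟨e 0, heH 0⟩, fun w w' w'' h h' => ?_, fun z h0 hz w hw => ?_⟩
  · obtain ⟨n, hn⟩ := ZFSet.mem_range.1 h
    obtain ⟨m, hm⟩ := ZFSet.mem_range.1 h'
    rw [ZFSet.pair_inj] at hn hm
    rw [← hn.2, ← hm.2, hei (hn.1.trans hm.1.symm)]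
  · have : ∀ n, e n ∈ (z : ZFSet.{u}) := by
      intro n
      induction n with
      | zero => exact h0
      | succ n ih =>
        exact hz ⟨e n, heH n⟩ ⟨e (n + 1), heH _⟩ ih (ZFSet.mem_range.2 ⟨n, rfl⟩)
    obtain ⟨n, rfl⟩ := hes w hw
    exact this n

/-! ### Countable elements of Skolem hulls -/

section Hull

variable {π : Ordinal.{u} → ZFSet.{u}} {Y : ZFSet.{u}} {a b : Set ZFSet.{u}}

theorem isDef_functional {ι : Type} (i : ι) :
    @IsDef modelLang (H (ℵ_ 2)) (modelStructure π Y) _ fun v => Functional (v i) := by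
  let _ := modelStructure π Y
  have h := isSetModel_modelLang π Y
  refine .all (.all (.all (.imp ?_ (.imp ?_ ?_))))
  · exact h.pair_mem (some (some (some i))) (some (some none)) (some none)
  · exact h.pair_mem (some (some (some i))) (some (some none)) none
  · exact h.eq (some none) none

theorem isDef_sweeps {ι : Type} (i j k : ι) :
    @IsDef modelLang (H (ℵ_ 2)) (modelStructure π Y) _ fun v => Sweeps (v i) (v j) (v k) := by
  let _ := modelStructure π Y
  have h := isSetModel_modelLang π Y
  refine .all (.imp ?_ (.imp (.all (.all (.imp ?_ (.imp ?_ ?_)))) ?_))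
  · exact h.mem (some j) none
  · exact h.mem (some none) (some (some none))
  · exact h.pair_mem (some (some (some i))) (some none) none
  · exact h.mem none (some (some none))
  · exact h.subset (some k) none

variable (hπ : Set.BijOn π (Set.Iio (ω_ 2)) (H (ℵ_ 2)))
include hπ

/-- Countable elements of a Skolem hull are subsets of it. -/
theorem subset_Sk_of_countable {x : ZFSet.{u}} (hx : x ∈ Sk π Y a)
    (hc : (x : Set ZFSet.{u}).Countable) : (x : Set ZFSet.{u}) ⊆ Sk π Y a := by
  let _ := modelStructure π Y
  have h := isSetModel_modelLang π Y
  obtain ⟨f, hf, hfun, hsw⟩ := Sk.exists₁ (a := a) (y := ⟨x, Sk_subset_H hx⟩)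
    (P := fun f x => Functional f ∧ ∃ x₀, Sweeps f x₀ x) hπ
    (.and (isDef_functional 0) (.ex (isDef_sweeps (some 0) none (some 1)))) hx
    (by obtain ⟨f, x₀, h₁, h₂⟩ := exists_sweeps (Sk_subset_H hx) hc; exact ⟨f, h₁, x₀, h₂⟩)
  obtain ⟨x₀, hx₀, hsw⟩ := Sk.exists₂ (a := a) (y := f) (z := ⟨x, Sk_subset_H hx⟩)
    (P := fun x₀ f x => Sweeps f x₀ x) hπ (isDef_sweeps 1 0 2) hf hx hsw
  obtain ⟨t, ht, hft, htc⟩ := f.2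
  -- The hull itself may be too large to be in `H(ω₂)`, so it is cut down to a small transitive set
  -- `t ⊇ f`. The result is closed under `f`: the hull has some `f`-successor of each of its
  -- elements that has one, and it is unique.
  have hzH : insert (x₀ : ZFSet.{u}) (t.sep (· ∈ Sk π Y a)) ∈ H (ℵ_ 2) :=
    H.insert isRegular_aleph_two x₀.2 ⟨t, ht, ZFSet.sep_subset, htc⟩
  have key := hsw ⟨_, hzH⟩ (ZFSet.mem_insert _ _) fun w w' hw hww' => by
    have hwS : (w : ZFSet.{u}) ∈ Sk π Y a := by
      rcases ZFSet.mem_insert_iff.1 hw with hw | hw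
      · rwa [hw]
      · exact (ZFSet.mem_sep.1 hw).2
    obtain ⟨w'', hw'', hp⟩ := Sk.exists₂ (a := a) (y := f) (z := w)
      (P := fun v f w => ZFSet.pair w v ∈ (f : ZFSet.{u})) hπ (h.pair_mem 1 2 0) hf hwS ⟨w', hww'⟩
    refine ZFSet.mem_insert_of_mem _ (ZFSet.mem_sep.2 ⟨?_, ?_⟩)
    · refine ht.mem_trans (y := {(w : ZFSet.{u}), (w' : ZFSet.{u})}) (by simp) ?_
      exact ht.mem_trans (by simp [ZFSet.pair]) (hft hww')
    · rwa [hfun _ _ _ hww' hp]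
  intro w hw
  rcases ZFSet.mem_insert_iff.1 (key hw) with hw | hw
  · rwa [hw]
  · exact (ZFSet.mem_sep.1 hw).2

/-- The cutoff `β` need not be in the hull. It can be replaced by the least element of `x` that is
at least `β`, which is in the hull because `x` is countable; if there is none, nothing is cut off.
-/
theorem inter_toZFSet_mem_Sk {x : ZFSet.{u}} (hx : x ∈ Sk π Y a)
    (hc : (x : Set ZFSet.{u}).Countable) (hord : ∀ y ∈ x, ∃ α : Ordinal.{u}, α.toZFSet = y)
    (β : Ordinal.{u}) : x ∩ β.toZFSet ∈ Sk π Y a := by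
  by_cases hne : {α : Ordinal.{u} | α.toZFSet ∈ x ∧ β ≤ α}.Nonempty
  · obtain ⟨α, ⟨hαx, hβα⟩, hmin⟩ := WellFounded.has_min Ordinal.lt_wf _ hne
    have : x ∩ β.toZFSet = x ∩ α.toZFSet := by
      ext y
      simp only [ZFSet.mem_inter, and_congr_right_iff]
      intro hy
      obtain ⟨γ, rfl⟩ := hord y hy
      rw [Ordinal.toZFSet_mem_toZFSet_iff, Ordinal.toZFSet_mem_toZFSet_iff]
      refine ⟨fun h => h.trans_le hβα, fun h => ?_⟩
      by_contra hγ
      exact hmin γ ⟨hy, not_lt.1 hγ⟩ h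
    rw [this]
    exact inter_mem_Sk hπ hx (subset_Sk_of_countable hπ hx hc hαx)
  · have : x ∩ β.toZFSet = x := by
      refine ZFSet.inter_eq_left_of_subset fun y hy => ?_
      obtain ⟨γ, rfl⟩ := hord y hy
      rw [Ordinal.toZFSet_mem_toZFSet_iff]
      by_contra hγ
      exact hne ⟨γ, hy, not_lt.1 hγ⟩
    rwa [this]

end Hull

/-! ### Thinness and the indices of elements of `Y` -/

section Thin

variable {π : Ordinal.{u} → ZFSet.{u}} {Y : ZFSet.{u}}

theorem IsThinStationary.mem_H (hY : IsThinStationary Y) {b : ZFSet.{u}} (hb : b ∈ Y) :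
    b ∈ H (ℵ_ 2) := by
  refine H.of_forall_mem isRegular_aleph_two
    (card_lt_of_countable (hY.subset b hb).2 aleph0_lt_aleph_two) fun y hy => ?_
  obtain ⟨α, hα, rfl⟩ := Ordinal.mem_toZFSet_iff.1 ((hY.subset b hb).1 hy)
  exact mem_toZFSet_H hα

/-- By thinness, the indices of the elements of `Y` below `γ` are bounded in `ω₂`. -/
theorem IsThinStationary.exists_index_bound (hY : IsThinStationary Y)
    (hπ : Set.BijOn π (Set.Iio (ω_ 2)) (H (ℵ_ 2))) {γ : Ordinal.{u}} (hγ : γ < ω_ 2) :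
    ∃ δ < ω_ 2, ∀ b ∈ Y, b ⊆ γ.toZFSet → ∃ α < δ, π α = b := by
  let s : Set Ordinal.{u} := {α | α < ω_ 2 ∧ π α ∈ Y ∧ π α ⊆ γ.toZFSet}
  have hs : #s ≤ ℵ_ 1 := by
    refine le_trans ?_ (hY.thin γ hγ)
    refine mk_le_of_injective (f := fun α : s => ⟨π α, π α, α.2.2.1, ?_⟩) fun α β h => ?_
    · exact (ZFSet.inter_eq_left_of_subset α.2.2.2).symm
    · exact Subtype.ext (hπ.injOn α.2.1 β.2.1 (congrArg Subtype.val h))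
  have hcof : #s < (Ordinal.lift.{u + 1} (ω_ 2 : Ordinal.{u})).cof := by
    rw [← Ordinal.lift_cof, isRegular_aleph_two.cof_omega_eq]
    refine hs.trans_lt ?_
    simp
  refine ⟨sSup ((· + 1) '' s), sSup_add_one_lt_of_lt_cof hcof fun _ h => h.1, fun b hb hbγ => ?_⟩
  obtain ⟨α, hα, rfl⟩ := hπ.surjOn (hY.mem_H hb)
  refine ⟨α, ?_, rfl⟩
  refine (lt_add_one α).trans_le (le_csSup ⟨ω_ 2, ?_⟩ ⟨α, ⟨hα, hb, hbγ⟩, rfl⟩)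
  rintro _ ⟨β, hβ, rfl⟩
  exact Order.add_one_le_of_lt hβ.1

/-- Some bound for the indices of the elements of `Y` included in `γ` is chosen in `Sk(δ)` by a
Skolem function with parameter `γ`. As `Sk(δ) ∩ ω₂ = δ`, this bound is below `δ`. -/
theorem clubC.exists_index_lt (hY : IsThinStationary Y)
    (hπ : Set.BijOn π (Set.Iio (ω_ 2)) (H (ℵ_ 2))) {γ δ : Ordinal.{u}} (hδ : δ ∈ clubC π Y)
    (hγ : γ < δ) {b : ZFSet.{u}} (hb : b ∈ Y) (hbγ : b ⊆ γ.toZFSet) : ∃ α < δ, π α = b := by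
  let _ := modelStructure π Y
  have h := isSetModel_modelLang π Y
  have hγ2 := hγ.trans hδ.1
  have hγS : γ.toZFSet ∈ Sk π Y δ.toZFSet :=
    (hδ.2.mem_iff hγ2).2 (Ordinal.toZFSet_mem_toZFSet_iff.2 hγ)
  -- The first conjunct says that `x` is in the domain of `π`, which is how the formula expresses
  -- that `x` is an ordinal below `ω₂`.
  obtain ⟨x, hx, ⟨y, ε, hε, hεx, _⟩, hxb⟩ := Sk.exists₁ (y := ⟨γ.toZFSet, mem_toZFSet_H hγ2⟩)
    (P := fun x g => (∃ y : H.{u} (ℵ_ 2), ∃ α < ω_ 2, α.toZFSet = (x : ZFSet.{u}) ∧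
        π α = (y : ZFSet.{u})) ∧
      ∀ b : H.{u} (ℵ_ 2), (b : ZFSet.{u}) ∈ Y → (b : ZFSet.{u}) ⊆ (g : ZFSet.{u}) →
        ∃ c : H.{u} (ℵ_ 2), (c : ZFSet.{u}) ∈ (x : ZFSet.{u}) ∧
          ∃ α < ω_ 2, α.toZFSet = (c : ZFSet.{u}) ∧ π α = (b : ZFSet.{u})) hπ
    (.and (.ex (isDef_enum π Y (some 0) none))
      (.all (.imp (isDef_side π Y none) (.imp (h.subset none (some 1))
        (.ex (.and (h.mem none (some (some 0))) (isDef_enum π Y none (some none)))))))) hγS (by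
      obtain ⟨ε, hε, hεb⟩ := hY.exists_index_bound hπ hγ2
      refine ⟨⟨ε.toZFSet, mem_toZFSet_H hε⟩, ⟨⟨π ε, hπ.mapsTo hε⟩, ε, hε, rfl, rfl⟩,
        fun b hb hbγ => ?_⟩
      obtain ⟨α, hα, hαb⟩ := hεb b hb hbγ
      exact ⟨⟨α.toZFSet, mem_toZFSet_H (hα.trans hε)⟩, Ordinal.toZFSet_mem_toZFSet_iff.2 hα,
        α, hα.trans hε, rfl, hαb⟩)
  rw [← hεx, hδ.2.mem_iff hε, Ordinal.toZFSet_mem_toZFSet_iff] at hx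
  obtain ⟨c, hcx, α, _, hαc, hαb⟩ := hxb ⟨b, hY.mem_H hb⟩ hb hbγ
  rw [← hαc, ← hεx, Ordinal.toZFSet_mem_toZFSet_iff] at hcx
  exact ⟨α, hcx.trans hx, hαb⟩

end Thin

/-! ### Comparison points -/

section Comparison

variable {Γ : Set Ordinal.{u}} {M N : ZFSet.{u}}

/-- Without suprema: `M` has an element strictly between `β` and each smaller point of `Γ`. In this
form monotonicity in `M` is immediate. -/
theorem mem_gammaOf_iff {β : Ordinal.{u}} : β ∈ gammaOf Γ M ↔
    β ∈ Γ ∧ ∀ γ ∈ Γ, γ < β → ∃ α : Ordinal.{u}, α.toZFSet ∈ M ∧ γ < α ∧ α < β := by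
  have hbdd : BddAbove (ordsOf M ∩ Set.Iio β) := ⟨β, fun _ h => le_of_lt h.2⟩
  have hle : ∀ γ, sSup (ordsOf M ∩ Set.Iio β) ≤ γ ↔
      ∀ α : Ordinal.{u}, α.toZFSet ∈ M → α < β → α ≤ γ := fun γ => by
    rw [csSup_le_iff' hbdd]
    exact ⟨fun h α h₁ h₂ => h α ⟨h₁, h₂⟩, fun h α hα => h α hα.1 hα.2⟩
  constructor
  · rintro ⟨⟨hβ, _⟩, hmin⟩
    refine ⟨hβ, fun γ hγ hγβ => ?_⟩
    by_contra! hcon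
    refine (hmin ⟨hγ, (hle γ).2 fun α hα hαβ => ?_⟩).not_gt hγβ
    by_contra! hlt
    exact (hcon α hα hlt).not_gt hαβ
  · rintro ⟨hβ, h⟩
    refine ⟨⟨hβ, (hle β).2 fun α _ h => h.le⟩, fun γ ⟨hγ, hsup⟩ => ?_⟩
    by_contra! hlt
    obtain ⟨α, hα, hγα, hαβ⟩ := h γ hγ hlt
    exact ((hle γ).1 hsup α hα hαβ).not_gt hγα

theorem gammaOf_mono (h : M ⊆ N) : gammaOf Γ M ⊆ gammaOf Γ N := fun β hβ => by
  rw [mem_gammaOf_iff] at hβ ⊢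
  refine ⟨hβ.1, fun γ hγ hlt => ?_⟩
  obtain ⟨α, hα, h'⟩ := hβ.2 γ hγ hlt
  exact ⟨α, h hα, h'⟩

theorem mem_gammaOf_inter {β η : Ordinal.{u}} (hβ : β ∈ gammaOf Γ M) (h : β ≤ η) :
    β ∈ gammaOf Γ (M ∩ η.toZFSet) := by
  rw [mem_gammaOf_iff] at hβ ⊢
  refine ⟨hβ.1, fun γ hγ hlt => ?_⟩
  obtain ⟨α, hα, hγα, hαβ⟩ := hβ.2 γ hγ hlt
  exact ⟨α, ZFSet.mem_inter.2 ⟨hα, Ordinal.toZFSet_mem_toZFSet_iff.2 (hαβ.trans_le h)⟩, hγα, hαβ⟩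

theorem le_of_mem_gammaOf_inter {β η : Ordinal.{u}} (hη : η ∈ Γ)
    (hβ : β ∈ gammaOf Γ (M ∩ η.toZFSet)) : β ≤ η := by
  by_contra! h
  obtain ⟨α, hα, hηα, _⟩ := (mem_gammaOf_iff.1 hβ).2 η hη h
  exact hηα.not_gt (Ordinal.toZFSet_mem_toZFSet_iff.1 (ZFSet.mem_inter.1 hα).2)

theorem exists_lt_of_countable {s : Set Ordinal.{u}} (hs : s.Countable) {β : Ordinal.{u}}
    (hβ : ℵ₀ < β.cof) (h : ∀ α ∈ s, α < β) : ∃ γ < β, ∀ α ∈ s, α < γ := by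
  refine ⟨sSup ((· + 1) '' s), sSup_add_one_lt_of_lt_cof ?_ h, fun α hα => ?_⟩
  · rw [← Ordinal.lift_cof]
    refine lt_of_le_of_lt (mk_le_aleph0_iff.2 hs.to_subtype) ?_
    have h := Cardinal.lift_lt.{u, u + 1}.2 hβ
    rwa [lift_aleph0] at h
  · refine (lt_add_one α).trans_le (le_csSup ⟨β, ?_⟩ ⟨α, hα, rfl⟩)
    rintro _ ⟨ξ, hξ, rfl⟩
    exact Order.add_one_le_of_lt (h ξ hξ)

theorem aleph_zero_lt_aleph_one : ℵ₀ < (ℵ_ 1 : Cardinal.{u}) := by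
  rw [← aleph_zero]
  exact aleph_lt_aleph.2 zero_lt_one

theorem countable_ordsOf (hM : (M : Set ZFSet.{u}).Countable) :
    {α : Ordinal.{u} | α.toZFSet ∈ M}.Countable :=
  hM.preimage Ordinal.toZFSet_injective

theorem cmpPoint_comm : cmpPoint Γ M N = cmpPoint Γ N M := by
  rw [cmpPoint, cmpPoint, Set.inter_comm]

/-- The comparison point of two countable sets is well defined. -/
theorem isGreatest_cmpPoint (hcof : ∀ β ∈ Γ, β < ω_ 2 ∧ β.cof = ℵ_ 1)
    (hunb : ∀ α < ω_ 2, ∃ β ∈ Γ, α ≤ β) (hM : (M : Set ZFSet.{u}).Countable) :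
    IsGreatest (gammaOf Γ M ∩ gammaOf Γ N) (cmpPoint Γ M N) := by
  set S := gammaOf Γ M ∩ gammaOf Γ N with hS
  have hSω : ∀ β ∈ S, β < ω_ 2 := fun β h => (hcof β (mem_gammaOf_iff.1 h.1).1).1
  have hbdd : BddAbove S := ⟨ω_ 2, fun β h => (hSω β h).le⟩
  have hω2 : (0 : Ordinal.{u}) < ω_ 2 := omega_pos 2
  -- The least element of `Γ` belongs to every `Γ_M`, vacuously.
  have hne : S.Nonempty := by
    obtain ⟨β, hβ, _⟩ := hunb 0 hω2
    obtain ⟨β, hβ, hmin⟩ := WellFounded.has_min Ordinal.lt_wf Γ ⟨β, hβ⟩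
    exact ⟨β, mem_gammaOf_iff.2 ⟨hβ, fun γ hγ h => absurd h (hmin γ hγ)⟩,
      mem_gammaOf_iff.2 ⟨hβ, fun γ hγ h => absurd h (hmin γ hγ)⟩⟩
  rw [cmpPoint, ← hS]
  set σ := sSup S with hσ
  by_cases hmem : σ ∈ S
  · exact ⟨hmem, fun β h => le_csSup hbdd h⟩
  exfalso
  have hlt : ∀ γ < σ, ∃ γ' ∈ S, γ < γ' ∧ γ' < σ := by
    intro γ hγ
    obtain ⟨γ', hγ', h⟩ := exists_lt_of_lt_csSup hne hγ
    exact ⟨γ', hγ', h, (le_csSup hbdd hγ').lt_of_ne fun (h : γ' = σ) => hmem (by rwa [← h])⟩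
  -- If the supremum `σ` is not attained, both sets have elements between successive members of `S`,
  -- hence are cofinal in `σ`. Countability of `M` then gives `σ` countable cofinality.
  have hacc : ∀ K, S ⊆ gammaOf Γ K → ∀ γ < σ, ∃ α : Ordinal.{u}, α.toZFSet ∈ K ∧ γ < α ∧ α < σ := by
    intro K hK γ hγ
    obtain ⟨γ₁, h₁, hγ₁, hσ₁⟩ := hlt γ hγ
    obtain ⟨γ₂, h₂, hγ₂, hσ₂⟩ := hlt γ₁ hσ₁
    obtain ⟨α, hα, h₃, h₄⟩ := (mem_gammaOf_iff.1 (hK h₂)).2 γ₁ (mem_gammaOf_iff.1 (hK h₁)).1 hγ₂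
    exact ⟨α, hα, hγ₁.trans h₃, h₄.trans hσ₂⟩
  have hcofσ : ¬ ℵ₀ < σ.cof := fun h => by
    obtain ⟨γ, hγ, hγM⟩ := exists_lt_of_countable
      ((countable_ordsOf hM).mono (s₁ := {α : Ordinal.{u} | α.toZFSet ∈ M ∧ α < σ}) fun _ h => h.1)
      h fun _ h => h.2
    obtain ⟨α, hα, hγα, hασ⟩ := hacc M Set.inter_subset_left γ hγ
    exact (hγM α ⟨hα, hασ⟩).not_gt hγα
  have hσω : σ < ω_ 2 := by
    refine lt_of_le_of_ne (csSup_le hne fun β h => (hSω β h).le) fun h => hcofσ ?_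
    rw [h, isRegular_aleph_two.cof_omega_eq]
    exact aleph0_lt_aleph_two
  -- The first point of `Γ` from `σ` on is not `σ`, as its cofinality is `ω₁`. Both sets are cofinal
  -- in `σ` and no point of `Γ` lies in between, so it belongs to `S`, although it exceeds the
  -- supremum.
  obtain ⟨β, hβ, hσβ⟩ := hunb σ hσω
  obtain ⟨β, ⟨hβ, hσβ⟩, hmin⟩ := WellFounded.has_min Ordinal.lt_wf {β | β ∈ Γ ∧ σ ≤ β} ⟨β, hβ, hσβ⟩
  have hne' : σ ≠ β := by
    rintro rfl
    exact hcofσ ((hcof _ hβ).2 ▸ aleph_zero_lt_aleph_one)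
  have hβK : ∀ K, S ⊆ gammaOf Γ K → β ∈ gammaOf Γ K := fun K hK =>
    mem_gammaOf_iff.2 ⟨hβ, fun γ hγ hγβ => by
      have hγσ : γ < σ := by
        by_contra! h
        exact hmin γ ⟨hγ, h⟩ hγβ
      obtain ⟨α, hα, h₁, h₂⟩ := hacc K hK γ hγσ
      exact ⟨α, hα, h₁, h₂.trans_le hσβ⟩⟩
  exact (le_csSup hbdd ⟨hβK M Set.inter_subset_left, hβK N Set.inter_subset_right⟩).not_gt
    (lt_of_le_of_ne hσβ hne')

end Comparison

theorem inter_inter_toZFSet {M : ZFSet.{u}} {β η : Ordinal.{u}} (h : β ≤ η) :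
    M ∩ η.toZFSet ∩ β.toZFSet = M ∩ β.toZFSet := by
  ext x
  simp only [ZFSet.mem_inter]
  exact ⟨fun hx => ⟨hx.1.1, hx.2⟩, fun hx => ⟨⟨hx.1, Ordinal.toZFSet_subset_toZFSet_iff.2 h hx.2⟩,
    hx.2⟩⟩

/-! ### Models -/

section Models

variable {π : Ordinal.{u} → ZFSet.{u}} {Y : ZFSet.{u}} {M N K : ZFSet.{u}}

theorem mem_models : M ∈ models π Y ↔ M ∈ Y ∧ SkClosed π Y M ∧
    ∀ γ ∈ ordsOf M, sSup (clubC π Y ∩ Set.Iio γ) ∈ ordsOf M :=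
  ZFSet.mem_sep

/-- `Λ ⊆ C`, in the form that is used. -/
theorem Lam.lt_of_mem_Sk {η α : Ordinal.{u}} (hη : η ∈ Lam π Y) (hα : α < ω_ 2)
    (h : α.toZFSet ∈ Sk π Y η.toZFSet) : α < η := by
  obtain ⟨_, hcof, hlim⟩ := hη
  have hpos : 0 < η := by
    rw [pos_iff_ne_zero]
    rintro rfl
    rw [Ordinal.cof_zero] at hcof
    exact (aleph_pos 1).ne hcof
  -- This covers Skolem functions without arguments, for which any `δ` will do.
  have hne : Nonempty {δ // δ ∈ clubC π Y ∧ δ < η} :=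
    let ⟨δ, hδ, _, h⟩ := hlim 0 hpos
    ⟨δ, hδ, h⟩
  -- `Sk(η)` is the union of the hulls of `δ ∈ C ∩ η`: each application of a Skolem function has
  -- finitely many arguments, all in the hull of one such `δ`.
  have key : ∀ x : H (ℵ_ 2), InSk π Y η.toZFSet x →
      ∃ δ : {δ // δ ∈ clubC π Y ∧ δ < η}, InSk π Y δ.1.toZFSet x := by
    intro x hx
    induction hx with
    | base x hx =>
      obtain ⟨ξ, hξ, hξx⟩ := Ordinal.mem_toZFSet_iff.1 (show x.1 ∈ η.toZFSet from hx)
      obtain ⟨δ, hδ, hξδ, hδη⟩ := hlim ξ hξ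
      exact ⟨⟨δ, hδ, hδη⟩, .base _ (show x.1 ∈ δ.toZFSet from
        Ordinal.mem_toZFSet_iff.2 ⟨ξ, hξδ, hξx⟩)⟩
    | skolem φ v x _ hx ih =>
      choose δ hδ using ih
      obtain ⟨ε, hε⟩ := Finite.exists_le δ
      refine ⟨ε, .skolem φ v x (fun i => ?_) hx⟩
      have hsub : ((δ i).1.toZFSet : Set ZFSet.{u}) ⊆ (ε.1.toZFSet : ZFSet.{u}) :=
        fun _ h => Ordinal.toZFSet_subset_toZFSet_iff.2 (hε i) h
      obtain ⟨y, hy, hyv⟩ := Sk_mono hsub ⟨v i, hδ i, rfl⟩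
      rwa [← Subtype.ext hyv]
  obtain ⟨x, hx, hxα⟩ := h
  obtain ⟨δ, hδ⟩ := key x hx
  have : α.toZFSet ∈ Sk π Y δ.1.toZFSet := ⟨x, hδ, hxα⟩
  rw [δ.2.1.2.mem_iff hα, Ordinal.toZFSet_mem_toZFSet_iff] at this
  exact this.trans δ.2.2

/-- Since `Sk(M ∩ η)` is included in both `Sk(M)` and `Sk(η)`, its ordinals below `ω₂` lie in `M`
and below `η`. The points `sup (C ∩ γ)` cause no trouble, being at most `γ`. -/
theorem inter_toZFSet_mem_models (hY : IsThinStationary Y) (hM : M ∈ models π Y)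
    {η : Ordinal.{u}} (hη : η ∈ Lam π Y) : M ∩ η.toZFSet ∈ models π Y := by
  obtain ⟨hMY, hMS, hMC⟩ := mem_models.1 hM
  have hsub : ((M ∩ η.toZFSet : ZFSet.{u}) : Set ZFSet.{u}) ⊆ (M : Set ZFSet.{u}) := fun x hx =>
    (ZFSet.mem_inter.1 hx).1
  have hsub' : ((M ∩ η.toZFSet : ZFSet.{u}) : Set ZFSet.{u}) ⊆ (η.toZFSet : ZFSet.{u}) :=
    fun x hx => (ZFSet.mem_inter.1 hx).2
  refine mem_models.2 ⟨hY.initial M hMY η hη.1, ?_, fun γ hγ => ?_⟩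
  · apply Set.Subset.antisymm
    · rintro x ⟨hx, hxω⟩
      obtain ⟨α, hα, rfl⟩ := Ordinal.mem_toZFSet_iff.1 hxω
      refine ZFSet.mem_inter.2 ⟨(hMS.mem_iff hα).1 (Sk_mono hsub hx), ?_⟩
      exact Ordinal.toZFSet_mem_toZFSet_iff.2 (Lam.lt_of_mem_Sk hη hα (Sk_mono hsub' hx))
    · intro x hx
      have hxω := (hY.subset M hMY).1 (hsub hx)
      obtain ⟨α, hα, rfl⟩ := Ordinal.mem_toZFSet_iff.1 hxω
      exact ⟨mem_Sk_of_mem hx (mem_toZFSet_H hα), hxω⟩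
  · have hγ' := ZFSet.mem_inter.1 (show γ.toZFSet ∈ M ∩ η.toZFSet from hγ)
    refine show Ordinal.toZFSet _ ∈ M ∩ η.toZFSet from ZFSet.mem_inter.2 ⟨hMC γ hγ'.1, ?_⟩
    refine Ordinal.toZFSet_mem_toZFSet_iff.2 (lt_of_le_of_lt ?_
      (Ordinal.toZFSet_mem_toZFSet_iff.1 hγ'.2))
    exact csSup_le' fun δ hδ => le_of_lt hδ.2

theorem ordinals_of_mem (hY : IsThinStationary Y) (hM : M ∈ Y) {x : ZFSet.{u}} (hx : x ∈ M) :
    ∃ α : Ordinal.{u}, α.toZFSet = x :=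
  let ⟨α, _, h⟩ := Ordinal.mem_toZFSet_iff.1 ((hY.subset M hM).1 hx)
  ⟨α, h⟩

variable (hπ : Set.BijOn π (Set.Iio (ω_ 2)) (H (ℵ_ 2))) (hY : IsThinStationary Y)
include hπ hY

/-- Elements of `Y` in the hull of `M` which are included in some `η ∈ Λ` are enumerated by an
element of `M ∩ η`. -/
theorem exists_index_of_mem_Sk (hM : SkClosed π Y M) {b : ZFSet.{u}} (hb : b ∈ Y)
    (hbM : b ∈ Sk π Y M) {η : Ordinal.{u}} (hη : η ∈ Lam π Y) (hbη : b ⊆ η.toZFSet) :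
    ∃ α < η, α.toZFSet ∈ M ∧ π α = b := by
  -- The set `b` is countable and `η` has cofinality `ω₁`, so `b` is bounded below `η`, and a point
  -- of `C` fits between the bound and `η`.
  obtain ⟨γ, hγ, hγb⟩ := exists_lt_of_countable (countable_ordsOf (hY.subset b hb).2)
    (hη.2.1 ▸ aleph_zero_lt_aleph_one) fun α hα =>
      Ordinal.toZFSet_mem_toZFSet_iff.1 (hbη (show α.toZFSet ∈ b from hα))
  obtain ⟨δ, hδ, hγδ, hδη⟩ := hη.2.2 γ hγ
  have hbγ : b ⊆ γ.toZFSet := fun x hx => by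
    obtain ⟨α, rfl⟩ := ordinals_of_mem hY hb hx
    exact Ordinal.toZFSet_mem_toZFSet_iff.2 (hγb α hx)
  obtain ⟨α, hα, hαb⟩ := clubC.exists_index_lt hY hπ hδ hγδ hb hbγ
  obtain ⟨β, hβ, hβM, hβb⟩ := (hM.mem_Sk_iff hπ).1 hbM
  rw [hπ.injOn hβ (hα.trans hδ.1) (hβb.trans hαb.symm)] at hβM
  exact ⟨α, hα.trans hδη, hβM, hαb⟩

theorem inter_mem_Sk_of_mem {a : Set ZFSet.{u}} (hK : K ∈ Y) (h : K ∈ Sk π Y a)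
    (β : Ordinal.{u}) : K ∩ β.toZFSet ∈ Sk π Y a :=
  inter_toZFSet_mem_Sk hπ h (hY.subset K hK).2 (fun _ => ordinals_of_mem hY hK) β

theorem subset_of_mem_Sk (hM : SkClosed π Y M) (hK : K ∈ Y) (h : K ∈ Sk π Y M) : K ⊆ M := by
  intro x hx
  obtain ⟨α, hα, rfl⟩ := Ordinal.mem_toZFSet_iff.1 ((hY.subset K hK).1 hx)
  exact (hM.mem_iff hα).1 (subset_Sk_of_countable hπ h (hY.subset K hK).2 hx)

end Models

/-- The requirement on pairs of models in the definition of adequate sets. -/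
def Comparable (π : Ordinal.{u} → ZFSet.{u}) (Y : ZFSet.{u}) (Γ : Set Ordinal.{u})
    (M N : ZFSet.{u}) : Prop :=
  M ∩ (cmpPoint Γ M N).toZFSet = N ∩ (cmpPoint Γ M N).toZFSet ∨
    M ∩ (cmpPoint Γ M N).toZFSet ∈ Sk π Y N ∨ N ∩ (cmpPoint Γ M N).toZFSet ∈ Sk π Y M

/-! ### Comparability under cutting and amalgamation -/

section Adequate

variable {π : Ordinal.{u} → ZFSet.{u}} {Y : ZFSet.{u}} {Γ : Set Ordinal.{u}} {M N K L : ZFSet.{u}}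

theorem Comparable.refl (M : ZFSet.{u}) : Comparable π Y Γ M M := Or.inl rfl

theorem Comparable.symm (h : Comparable π Y Γ M N) : Comparable π Y Γ N M := by
  unfold Comparable at *
  rw [cmpPoint_comm]
  rcases h with h | h | h
  · exact Or.inl h.symm
  · exact Or.inr (Or.inr h)
  · exact Or.inr (Or.inl h)

variable (hπ : Set.BijOn π (Set.Iio (ω_ 2)) (H (ℵ_ 2))) (hY : IsThinStationary Y)
  (hΓ : Γ ⊆ Lam π Y) (hunb : ∀ α < ω_ 2, ∃ β ∈ Γ, α ≤ β)

include hY hΓ hunb in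
theorem isGreatest_cmpPoint_of_mem (hM : M ∈ Y) :
    IsGreatest (gammaOf Γ M ∩ gammaOf Γ N) (cmpPoint Γ M N) :=
  isGreatest_cmpPoint (fun _ h => ⟨(hΓ h).1, (hΓ h).2.1⟩) hunb (hY.subset M hM).2

include hY hΓ hunb in
theorem cmpPoint_mem (hM : M ∈ Y) : cmpPoint Γ M N ∈ Γ :=
  (mem_gammaOf_iff.1 (isGreatest_cmpPoint_of_mem hY hΓ hunb (N := N) hM).1.1).1

include hπ hY hΓ hunb

/-- The new comparison point `β` is at most both `η` and the old one, so each alternative can be cut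
at `β`. Only `L ∩ β ∈ Sk(M)` needs work: the hull must shrink to that of `M ∩ η`, and it may because
the index of `L ∩ β` lies in `M ∩ β`. -/
theorem Comparable.inter_left (hM : M ∈ models π Y) (hL : L ∈ models π Y)
    (h : Comparable π Y Γ M L) {η : Ordinal.{u}} (hη : η ∈ Γ) :
    Comparable π Y Γ (M ∩ η.toZFSet) L := by
  have hMY := (mem_models.1 hM).1
  have hLY := (mem_models.1 hL).1
  have hM'Y := hY.initial M hMY η (hΓ hη).1
  have hsub : M ∩ η.toZFSet ⊆ M := fun _ h => (ZFSet.mem_inter.1 h).1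
  have hgr := isGreatest_cmpPoint_of_mem hY hΓ hunb (N := L) hM'Y
  have hβη := le_of_mem_gammaOf_inter hη hgr.1.1
  have hβc := (isGreatest_cmpPoint_of_mem hY hΓ hunb (N := L) hMY).2
    ⟨gammaOf_mono hsub hgr.1.1, hgr.1.2⟩
  have hβΓ := (mem_gammaOf_iff.1 hgr.1.1).1
  have hcω := (hΓ (cmpPoint_mem hY hΓ hunb (N := L) hMY)).1
  unfold Comparable at *
  set β := cmpPoint Γ (M ∩ η.toZFSet) L
  set c := cmpPoint Γ M L
  rw [inter_inter_toZFSet hβη, ← inter_inter_toZFSet (M := M) hβc,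
    ← inter_inter_toZFSet (M := L) hβc]
  rcases h with h | h | h
  · exact Or.inl (by rw [h])
  · exact Or.inr (Or.inl (inter_mem_Sk_of_mem hπ hY (hY.initial M hMY c hcω) h β))
  · right; right
    have hLc := inter_mem_Sk_of_mem hπ hY (hY.initial L hLY c hcω) h β
    rw [inter_inter_toZFSet hβc] at hLc ⊢
    obtain ⟨α, hα, hαM, hαL⟩ := exists_index_of_mem_Sk hπ hY (mem_models.1 hM).2.1
      (hY.initial L hLY β (hΓ hβΓ).1) hLc (hΓ hβΓ) fun _ h => (ZFSet.mem_inter.1 h).2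
    rw [← hαL]
    exact apply_mem_Sk_of_mem hπ (hα.trans (hΓ hβΓ).1) (show α.toZFSet ∈ M ∩ η.toZFSet from
      ZFSet.mem_inter.2 ⟨hαM, Ordinal.toZFSet_mem_toZFSet_iff.2 (hα.trans_le hβη)⟩)

theorem Comparable.inter_inter (hM : M ∈ models π Y) (hL : L ∈ models π Y)
    (h : Comparable π Y Γ M L) {η ζ : Ordinal.{u}} (hη : η ∈ Γ) (hζ : ζ ∈ Γ) :
    Comparable π Y Γ (M ∩ η.toZFSet) (L ∩ ζ.toZFSet) :=
  ((h.inter_left hπ hY hΓ hunb hM hL hη).symm.inter_left hπ hY hΓ hunb hL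
    (inter_toZFSet_mem_models hY hM (hΓ hη)) hζ).symm

/-- A model `K` in the hull of `N` is comparable with `M`, provided that it is comparable with
`M ∩ β_{M,N}` when the latter is in the hull of `N`. -/
theorem Comparable.of_mem_Sk (hM : M ∈ models π Y) (hN : N ∈ models π Y) (hK : K ∈ models π Y)
    (hKN : K ∈ Sk π Y N) (h : Comparable π Y Γ M N)
    (hMK : M ∩ (cmpPoint Γ M N).toZFSet ∈ Sk π Y N →
      Comparable π Y Γ (M ∩ (cmpPoint Γ M N).toZFSet) K) : Comparable π Y Γ M K := by
  obtain ⟨hMY, hMS, -⟩ := mem_models.1 hM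
  obtain ⟨hNY, hNS, -⟩ := mem_models.1 hN
  have hKY := (mem_models.1 hK).1
  have hKsub := subset_of_mem_Sk hπ hY hNS hKY hKN
  have hgr := isGreatest_cmpPoint_of_mem hY hΓ hunb (N := K) hMY
  have hβc := (isGreatest_cmpPoint_of_mem hY hΓ hunb (N := N) hMY).2
    ⟨hgr.1.1, gammaOf_mono hKsub hgr.1.2⟩
  have hβΓ := (mem_gammaOf_iff.1 hgr.1.1).1
  have hcω := (hΓ (cmpPoint_mem hY hΓ hunb (N := N) hMY)).1
  -- This settles two alternatives at once. The set `K ∩ β_{M,K}` has its index in `N` below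
  -- `β_{M,K} ≤ β_{M,N}`, hence in `M`.
  have hsubM : N ∩ (cmpPoint Γ M N).toZFSet ⊆ M → Comparable π Y Γ M K := by
    intro hsub
    right; right
    obtain ⟨α, hα, hαN, hαK⟩ := exists_index_of_mem_Sk hπ hY hNS
      (hY.initial K hKY _ (hΓ hβΓ).1) (inter_mem_Sk_of_mem hπ hY hKY hKN _) (hΓ hβΓ)
      fun _ h => (ZFSet.mem_inter.1 h).2
    rw [← hαK]
    exact apply_mem_Sk_of_mem hπ (hα.trans (hΓ hβΓ).1) (show α.toZFSet ∈ M from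
      hsub (ZFSet.mem_inter.2 ⟨hαN, Ordinal.toZFSet_mem_toZFSet_iff.2 (hα.trans_le hβc)⟩))
  rcases id h with h | h | h
  · exact hsubM fun x hx => by
      rw [← h] at hx
      exact (ZFSet.mem_inter.1 hx).1
  · have hcmp := hMK h
    have hgr' := isGreatest_cmpPoint_of_mem hY hΓ hunb (N := K) (hY.initial M hMY _ hcω)
    -- Cutting `M` at `β_{M,N}` leaves its comparison point with `K` unchanged, so comparability of
    -- the cut model transfers to `M`.
    have heq : cmpPoint Γ (M ∩ (cmpPoint Γ M N).toZFSet) K = cmpPoint Γ M K := by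
      refine le_antisymm (hgr.2 ⟨gammaOf_mono ?_ hgr'.1.1, hgr'.1.2⟩)
        (hgr'.2 ⟨mem_gammaOf_inter hgr.1.1 hβc, hgr.1.2⟩)
      exact fun _ h => (ZFSet.mem_inter.1 h).1
    have hsub : ((M ∩ (cmpPoint Γ M N).toZFSet : ZFSet.{u}) : Set ZFSet.{u}) ⊆
        (M : Set ZFSet.{u}) := fun _ h => (ZFSet.mem_inter.1 h).1
    unfold Comparable at hcmp ⊢
    rw [heq, inter_inter_toZFSet hβc] at hcmp
    exact hcmp.imp_right (Or.imp_right fun h => Sk_mono hsub h)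
  · exact hsubM (subset_of_mem_Sk hπ hY hMS (hY.initial N hNY _ hcω) h)

end Adequate

/-! ### Strongly generic conditions -/

section StronglyGeneric

variable {π : Ordinal.{u} → ZFSet.{u}} {Y : ZFSet.{u}} {Γ : Set Ordinal.{u}} {N : ZFSet.{u}}

theorem mem_adequatePoset {A : ZFSet.{u}} : A ∈ (adequatePoset π Y Γ).carrier ↔
    (A : Set ZFSet.{u}).Finite ∧ (∀ M ∈ A, M ∈ models π Y) ∧
      ∀ M ∈ A, ∀ N ∈ A, Comparable π Y Γ M N := by
  unfold adequatePoset
  simp only [ZFSet.mem_sep, ZFSet.mem_powerset]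
  exact ⟨fun h => ⟨h.2.1, fun M hM => h.1 hM, h.2.2.2⟩, fun h => ⟨fun M hM => h.2.1 M hM, h.1,
    fun M hM => h.2.1 M hM, h.2.2⟩⟩

theorem mem_H_of_mem_adequatePoset (hY : IsThinStationary Y) {A : ZFSet.{u}}
    (hA : A ∈ (adequatePoset π Y Γ).carrier) : A ∈ H (ℵ_ 2) := by
  obtain ⟨hfin, hmod, -⟩ := mem_adequatePoset.1 hA
  exact H.of_forall_mem isRegular_aleph_two (card_lt_of_countable hfin.countable
    aleph0_lt_aleph_two) fun M hM => hY.mem_H (mem_models.1 (hmod M hM)).1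

variable (hπ : Set.BijOn π (Set.Iio (ω_ 2)) (H (ℵ_ 2))) (hY : IsThinStationary Y)
  (hΓ : Γ ⊆ Lam π Y) (hunb : ∀ α < ω_ 2, ∃ β ∈ Γ, α ≤ β)

include hπ hY in
-- A finite `A ∈ Sk(N)` is included in `Sk(N)`, and so is every initial segment of its models. Hence
-- the alternative `M ∩ β_{M,N} ∈ Sk(N)` always holds.
theorem insert_mem_adequatePoset (hN : N ∈ models π Y) {A : ZFSet.{u}}
    (hA : A ∈ (adequatePoset π Y Γ).carrier) (hAN : A ∈ Sk π Y N) :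
    insert N A ∈ (adequatePoset π Y Γ).carrier := by
  obtain ⟨hfin, hmod, hcmp⟩ := mem_adequatePoset.1 hA
  have hN' : ∀ M ∈ A, Comparable π Y Γ M N := fun M hM =>
    Or.inr (Or.inl (inter_mem_Sk_of_mem hπ hY (mem_models.1 (hmod M hM)).1
      (subset_Sk_of_countable hπ hAN hfin.countable hM) _))
  refine mem_adequatePoset.2 ⟨?_, fun M hM => ?_, fun M hM L hL => ?_⟩
  · rw [ZFSet.coe_insert]
    exact hfin.insert N
  · rcases ZFSet.mem_insert_iff.1 hM with rfl | hM
    · exact hN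
    · exact hmod M hM
  · rcases ZFSet.mem_insert_iff.1 hM with h₁ | h₁ <;>
      rcases ZFSet.mem_insert_iff.1 hL with h₂ | h₂
    · exact h₁ ▸ h₂ ▸ .refl _
    · exact h₁ ▸ (hN' L h₂).symm
    · exact h₂ ▸ hN' M h₁
    · exact hcmp M h₁ L h₂

include hπ hY hΓ hunb

/-- Conditions containing `N` are strongly generic for sets with the same trace on `H(ω₂)` as the
hull of `N`. -/
theorem isStronglyGeneric_of_mem {Nstar : Set ZFSet.{u}} (hNstar : Nstar ∩ H (ℵ_ 2) = Sk π Y N)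
    {q : ZFSet.{u}} (hq : q ∈ (adequatePoset π Y Γ).carrier) (hNq : N ∈ q) :
    (adequatePoset π Y Γ).IsStronglyGeneric Nstar q := by
  refine ⟨hq, fun D hD r hr hrq => ?_⟩
  have hNr : N ∈ r := hrq hNq
  obtain ⟨hrfin, hrmod, hrcmp⟩ := mem_adequatePoset.1 hr
  have hN := hrmod N hNr
  have hcΓ : ∀ M ∈ r, cmpPoint Γ M N ∈ Γ := fun M hM =>
    cmpPoint_mem hY hΓ hunb (mem_models.1 (hrmod M hM)).1
  -- The projection of `r` to `N`. It need not be a subset of `r`; what matters is that extensions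
  -- of it inside `Nstar` are compatible with `r`.
  let p : ZFSet.{u} := Y.sep fun K => K ∈ Sk π Y N ∧ ∃ M ∈ r, K = M ∩ (cmpPoint Γ M N).toZFSet
  have hpfin : (p : Set ZFSet.{u}).Finite := by
    refine (hrfin.image fun M => M ∩ (cmpPoint Γ M N).toZFSet).subset fun K hK => ?_
    obtain ⟨-, -, M, hM, rfl⟩ := ZFSet.mem_sep.1 hK
    exact ⟨M, hM, rfl⟩
  have hp : p ∈ (adequatePoset π Y Γ).carrier := by
    refine mem_adequatePoset.2 ⟨hpfin, fun K hK => ?_, fun K hK L hL => ?_⟩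
    · obtain ⟨-, -, M, hM, rfl⟩ := ZFSet.mem_sep.1 hK
      exact inter_toZFSet_mem_models hY (hrmod M hM) (hΓ (hcΓ M hM))
    · obtain ⟨-, -, M, hM, rfl⟩ := ZFSet.mem_sep.1 hK
      obtain ⟨-, -, M', hM', rfl⟩ := ZFSet.mem_sep.1 hL
      exact (hrcmp M hM M' hM').inter_inter hπ hY hΓ hunb (hrmod M hM) (hrmod M' hM')
        (hcΓ M hM) (hcΓ M' hM')
  have hpN : p ∈ Sk π Y N := mem_Sk_of_finite hπ hpfin fun K hK => (ZFSet.mem_sep.1 hK).2.1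
  rw [← hNstar] at hpN
  obtain ⟨d, hd, hpd⟩ := hD.2 p ⟨hpN.1, hp⟩
  have hdc := (hD.1 hd).2
  have hdN : d ∈ Sk π Y N := hNstar ▸ ⟨(hD.1 hd).1, mem_H_of_mem_adequatePoset hY hdc⟩
  obtain ⟨hdfin, hdmod, hdcmp⟩ := mem_adequatePoset.1 hdc
  have hcross : ∀ M ∈ r, ∀ K ∈ d, Comparable π Y Γ M K := fun M hM K hK =>
    (hrcmp M hM N hNr).of_mem_Sk hπ hY hΓ hunb (hrmod M hM) hN (hdmod K hK)
      (subset_Sk_of_countable hπ hdN hdfin.countable hK) fun h =>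
        hdcmp _ (hpd (ZFSet.mem_sep.2 ⟨hY.initial M (mem_models.1 (hrmod M hM)).1 _
          (hΓ (hcΓ M hM)).1, h, M, hM, rfl⟩)) K hK
  refine ⟨d, hd, d ∪ r, mem_adequatePoset.2 ⟨?_, fun M hM => ?_, fun M hM K hK => ?_⟩,
    fun x hx => ZFSet.mem_union.2 (Or.inl hx), fun x hx => ZFSet.mem_union.2 (Or.inr hx)⟩
  · rw [ZFSet.coe_union]
    exact hdfin.union hrfin
  · rcases ZFSet.mem_union.1 hM with hM | hM
    exacts [hdmod M hM, hrmod M hM]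
  · rcases ZFSet.mem_union.1 hM with hM | hM <;> rcases ZFSet.mem_union.1 hK with hK | hK
    · exact hdcmp M hM K hK
    · exact (hcross K hK M hM).symm
    · exact hcross M hM K hK
    · exact hrcmp M hM K hK

end StronglyGeneric

/-- The trace on `H(ω₂)` of an elementary submodel is the hull of its trace on `ω₂`. -/
theorem IsElemSubmodel.inter_H_eq {π : Ordinal.{u} → ZFSet.{u}} {Y N : ZFSet.{u}}
    (hπ : Set.BijOn π (Set.Iio (ω_ 2)) (H (ℵ_ 2))) {θ : Cardinal.{u}} (hθ : ℵ_ 2 < θ)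
    {Nstar : Set ZFSet.{u}} (hNstar : IsElemSubmodel θ Nstar) (hgraph : graphOf π ∈ Nstar)
    (hN : SkClosed π Y N)
    (hNeq : (N : Set ZFSet.{u}) = Nstar ∩ ((ω_ 2).toZFSet : ZFSet.{u})) :
    Nstar ∩ H (ℵ_ 2) = Sk π Y N := by
  have hsub : Nstar ⊆ H θ := by
    obtain ⟨S, rfl⟩ := hNstar
    rintro _ ⟨x, -, rfl⟩
    exact x.2
  have hmem : ∀ {x y : ZFSet.{u}}, ZFSet.pair x y ∈ graphOf π →
      ∃ α < ω_ 2, α.toZFSet = x ∧ π α = y := by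
    intro x y h
    obtain ⟨α, hα⟩ := ZFSet.mem_range.1 h
    rw [ZFSet.pair_inj] at hα
    exact ⟨α, α.2, hα⟩
  have hset := isSetModel_setLang θ
  apply Set.Subset.antisymm
  · rintro x ⟨hx, hxH⟩
    obtain ⟨α, hα, rfl⟩ := hπ.surjOn hxH
    obtain ⟨y, hy, hyx⟩ := hNstar.exists_of_isDef (n := 2) (hset.pair_mem 1 0 2)
      (v := ![⟨graphOf π, hsub hgraph⟩, ⟨π α, hsub hx⟩])
      (by intro i; fin_cases i <;> simpa)
      ⟨⟨α.toZFSet, H_mono hθ.le (mem_toZFSet_H hα)⟩, ZFSet.mem_range.2 ⟨⟨α, hα⟩, rfl⟩⟩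
    obtain ⟨β, hβ, hβy, hβα⟩ := hmem hyx
    have hβN : β.toZFSet ∈ (N : Set ZFSet.{u}) := by
      rw [hNeq]
      refine ⟨hβy ▸ hy, Ordinal.toZFSet_mem_toZFSet_iff.2 hβ⟩
    exact (hN.mem_Sk_iff hπ).2 ⟨β, hβ, hβN, hβα⟩
  · intro x hx
    refine ⟨?_, Sk_subset_H hx⟩
    obtain ⟨α, hα, hαN, rfl⟩ := (hN.mem_Sk_iff hπ).1 hx
    have hαN' : α.toZFSet ∈ (N : Set ZFSet.{u}) := hαN
    rw [hNeq] at hαN'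
    obtain ⟨y, hy, hyx⟩ := hNstar.exists_of_isDef (n := 2) (hset.pair_mem 1 2 0)
      (v := ![⟨graphOf π, hsub hgraph⟩, ⟨α.toZFSet, hsub hαN'.1⟩])
      (by intro i; fin_cases i; exacts [hgraph, hαN'.1])
      ⟨⟨π α, H_mono hθ.le (hπ.mapsTo hα)⟩, ZFSet.mem_range.2 ⟨⟨α, hα⟩, rfl⟩⟩
    obtain ⟨β, hβ, hβα, hβy⟩ := hmem hyx
    rw [Ordinal.toZFSet_injective hβα] at hβy
    change π α = (y : ZFSet.{u}) at hβy
    rwa [hβy]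

/-! ### Existence of elementary submodels with trace in a stationary set -/

section Submodels

open FirstOrder

instance : Countable setLang.Symbols :=
  have : Countable (Σ l, setLang.Functions l) :=
    (inferInstance : Countable (Σ _ : ℕ, Empty))
  have : Countable (Σ l, setLang.Relations l) :=
    Function.Injective.countable (f := fun _ => ()) (by rintro ⟨_, ⟨⟩⟩ ⟨_, ⟨⟩⟩ _; rfl)
  inferInstanceAs (Countable ((Σ l, setLang.Functions l) ⊕ Σ l, setLang.Relations l))

instance : Countable modelLang.Symbols :=
  have : Countable (Σ l, modelLang.Functions l) :=
    (inferInstance : Countable (Σ _ : ℕ, Empty))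
  have : Countable (Σ l, modelLang.Relations l) :=
    Function.Injective.countable (f := fun r : Σ l, ModelRel l => match r with
      | ⟨_, .mem⟩ => 0
      | ⟨_, .enum⟩ => 1
      | ⟨_, .side⟩ => 2) (by rintro ⟨_, ⟨⟩⟩ ⟨_, ⟨⟩⟩ h <;> simp_all)
  inferInstanceAs (Countable ((Σ l, modelLang.Functions l) ⊕ Σ l, modelLang.Relations l))

instance countable_boundedFormula {L : Language} [Countable L.Symbols] {α : Type*} [Countable α]
    (n : ℕ) : Countable (L.BoundedFormula α n) :=
  Function.Injective.countable (f := fun φ => (⟨n, φ⟩ : Σ n, L.BoundedFormula α n))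
    sigma_mk_injective

theorem countable_tuples {X : Set ZFSet.{u}} (e : Finset ZFSet.{u}) (n : ℕ) :
    Countable {v : Fin n → X // ∀ i, (v i : ZFSet.{u}) ∈ e} :=
  Function.Injective.countable (f := fun v (i : Fin n) => (⟨v.1 i, v.2 i⟩ : e)) fun _ _ h =>
    Subtype.ext (funext fun i => Subtype.ext (congrArg (Subtype.val (p := (· ∈ e))) (congrFun h i)))

/-- Chosen witnesses for the formulas with parameters in `e` which have one in `H(θ)`. -/
def elemWitnesses (θ : Cardinal.{u}) (e : Finset ZFSet.{u}) : Set ZFSet.{u} :=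
  ⋃ p : Σ n, setLang.BoundedFormula Empty (n + 1) ×
      {v : Fin n → H θ // ∀ i, (v i : ZFSet.{u}) ∈ e},
    {x | ∃ h : ∃ y : H θ, p.2.1.Realize default (Fin.snoc p.2.2.1 y : Fin (p.1 + 1) → H θ),
      x = h.choose}

theorem elemWitnesses_countable (θ : Cardinal.{u}) (e : Finset ZFSet.{u}) :
    (elemWitnesses θ e).Countable := by
  have := fun n => countable_tuples (X := H θ) e n
  refine Set.countable_iUnion fun p => Set.Subsingleton.countable ?_
  rintro _ ⟨h, rfl⟩ _ ⟨_, rfl⟩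
  rfl

theorem elemWitnesses_subset (θ : Cardinal.{u}) (e : Finset ZFSet.{u}) :
    elemWitnesses θ e ⊆ H θ := by
  refine Set.iUnion_subset fun p => ?_
  rintro _ ⟨h, rfl⟩
  exact h.choose.2

theorem exists_finset_of_fin {α : Type*} {n : ℕ} (v : Fin n → α) {s : Set α} (h : ∀ i, v i ∈ s) :
    ∃ e : Finset α, (e : Set α) ⊆ s ∧ ∀ i, v i ∈ e := by
  classical
  exact ⟨Finset.univ.image v, by rintro _ h'; obtain ⟨i, -, rfl⟩ := Finset.mem_image.1 h'; exact h i,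
    fun i => Finset.mem_image_of_mem v (Finset.mem_univ i)⟩

/-- This is the Tarski–Vaught criterion: the parameters of a formula form a finite subset of `N`. -/
theorem isElemSubmodel_of_closed {θ : Cardinal.{u}} {N : Set ZFSet.{u}} (hN : N ⊆ H θ)
    (h : ∀ e : Finset ZFSet.{u}, (e : Set ZFSet.{u}) ⊆ N → elemWitnesses θ e ⊆ N) :
    IsElemSubmodel θ N := by
  let S : setLang.Substructure (H θ) :=
    { carrier := {x | (x : ZFSet.{u}) ∈ N}
      fun_mem := fun f => f.elim }
  refine ⟨S.toElementarySubstructure fun n φ v a ha => ?_, ?_⟩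
  · obtain ⟨e, he, hev⟩ := exists_finset_of_fin (fun i => (v i : ZFSet.{u})) (s := N)
      fun i => (v i).2
    have hex : ∃ y : H θ, φ.Realize default (Fin.snoc ((↑) ∘ v) y : Fin (n + 1) → H θ) := ⟨a, ha⟩
    have hmem : (hex.choose : ZFSet.{u}) ∈ N :=
      h e he (Set.mem_iUnion.2 ⟨⟨n, φ, ⟨fun i => (v i : H θ), hev⟩⟩, hex, rfl⟩)
    exact ⟨⟨hex.choose, hmem⟩, hex.choose_spec⟩
  · ext x
    exact ⟨fun hx => ⟨⟨x, hN hx⟩, hx, rfl⟩, by rintro ⟨y, hy, rfl⟩; exact hy⟩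

variable {π : Ordinal.{u} → ZFSet.{u}} {Y : ZFSet.{u}}

/-- The values of the Skolem functions of `𝒜` at the tuples from `e`. -/
def skolemValues (π : Ordinal.{u} → ZFSet.{u}) (Y : ZFSet.{u}) (e : Finset ZFSet.{u}) :
    Set ZFSet.{u} :=
  ⋃ p : Σ n, modelLang.Formula (Fin (n + 1)) ×
      {v : Fin n → H (ℵ_ 2) // ∀ i, (v i : ZFSet.{u}) ∈ e},
    Subtype.val '' {x : H (ℵ_ 2) | IsSkolemValue π Y p.2.1 p.2.2.1 x}

theorem skolemValues_countable (π : Ordinal.{u} → ZFSet.{u}) (Y : ZFSet.{u})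
    (e : Finset ZFSet.{u}) : (skolemValues π Y e).Countable := by
  have := fun n => countable_tuples (X := H (ℵ_ 2)) e n
  refine Set.countable_iUnion fun p => (Set.Subsingleton.countable ?_).image _
  rintro x ⟨hx, α, hα, hαx, hαmin⟩ y ⟨hy, β, hβ, hβy, hβmin⟩
  rcases lt_trichotomy α β with h | rfl | h
  · exact absurd hx (hβmin α h x hαx)
  · exact Subtype.ext (hαx.symm.trans hβy)
  · exact absurd hy (hαmin β h y hβy)

theorem skolemValues_subset (π : Ordinal.{u} → ZFSet.{u}) (Y : ZFSet.{u})
    (e : Finset ZFSet.{u}) : skolemValues π Y e ⊆ H (ℵ_ 2) := by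
  refine Set.iUnion_subset fun p => ?_
  rintro _ ⟨x, -, rfl⟩
  exact x.2

theorem Sk_subset_of_closed {a N : Set ZFSet.{u}} (ha : a ⊆ N)
    (h : ∀ e : Finset ZFSet.{u}, (e : Set ZFSet.{u}) ⊆ N → skolemValues π Y e ⊆ N) :
    Sk π Y a ⊆ N := by
  rintro _ ⟨x, hx, rfl⟩
  have hx' : InSk π Y a x := hx
  clear hx
  induction hx' with
  | base x hx => exact ha hx
  | skolem φ v x _ hx ih =>
    obtain ⟨e, he, hev⟩ := exists_finset_of_fin (fun i => (v i : ZFSet.{u})) ih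
    exact h e he (Set.mem_iUnion.2 ⟨⟨_, φ, ⟨v, hev⟩⟩, x, hx, rfl⟩)

/-- The ordinals `sup (C ∩ γ)` for `γ ∈ e`. -/
noncomputable def clubSups (π : Ordinal.{u} → ZFSet.{u}) (Y : ZFSet.{u}) (e : Finset ZFSet.{u}) :
    Set ZFSet.{u} :=
  (fun γ : Ordinal.{u} => (sSup (clubC π Y ∩ Set.Iio γ)).toZFSet) '' ordsOf e

theorem clubSups_countable (π : Ordinal.{u} → ZFSet.{u}) (Y : ZFSet.{u}) (e : Finset ZFSet.{u}) :
    (clubSups π Y e).Countable :=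
  (e.countable_toSet.preimage Ordinal.toZFSet_injective).image _

theorem clubSups_subset {θ : Cardinal.{u}} {e : Finset ZFSet.{u}}
    (he : (e : Set ZFSet.{u}) ⊆ H θ) : clubSups π Y e ⊆ H θ := by
  rintro _ ⟨γ, hγ, rfl⟩
  exact H.subset (he hγ) (Ordinal.toZFSet_subset_toZFSet_iff.2 (csSup_le' fun δ hδ => le_of_lt hδ.2))

theorem graphOf_mem_H (hπ : Set.BijOn π (Set.Iio (ω_ 2)) (H (ℵ_ 2))) {θ : Cardinal.{u}}
    (hreg : θ.IsRegular) (hθ : ℵ_ 2 < θ) : graphOf π ∈ H θ := by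
  refine H.of_forall_mem hreg (lt_of_le_of_lt ?_ hθ) fun y hy => ?_
  · have h := ZFSet.lift_card_range_le
      (f := fun α : Set.Iio (ω_ 2 : Ordinal.{u}) => ZFSet.pair α.1.toZFSet (π α))
    rw [Cardinal.mk_Iio_ordinal, Ordinal.card_omega, Cardinal.lift_lift] at h
    exact Cardinal.lift_le.1 h
  · obtain ⟨α, rfl⟩ := ZFSet.mem_range.1 hy
    exact H.pair hreg (H_mono hθ.le (mem_toZFSet_H α.2)) (H_mono hθ.le (hπ.mapsTo α.2))

/-- All closure requirements are countable sets attached to finite sets, so a single lifting of the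
stationarity of `Y` meets them together. The free parameter `F` allows further demands on the
submodel. -/
theorem exists_submodel (hπ : Set.BijOn π (Set.Iio (ω_ 2)) (H (ℵ_ 2)))
    (hY : IsThinStationary Y) {θ : Cardinal.{u}} (hreg : θ.IsRegular) (hθ : ℵ_ 2 < θ)
    {C : Set (Set ZFSet.{u})} (hC : IsClubOfCountable (H θ) C)
    (F : Finset ZFSet.{u} → Set ZFSet.{u})
    (hF : ∀ e : Finset ZFSet.{u}, (e : Set ZFSet.{u}) ⊆ H θ → F e ⊆ H θ ∧ (F e).Countable) :
    ∃ Nstar ∈ C, (∀ e : Finset ZFSet.{u}, (e : Set ZFSet.{u}) ⊆ Nstar → F e ⊆ Nstar) ∧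
      IsElemSubmodel θ Nstar ∧ graphOf π ∈ Nstar ∧
      ∃ N ∈ models π Y, (N : Set ZFSet.{u}) = Nstar ∩ ((ω_ 2).toZFSet : ZFSet.{u}) := by
  have hωH : (((ω_ 2).toZFSet : ZFSet.{u}) : Set ZFSet.{u}) ⊆ H θ := fun x hx => by
    obtain ⟨α, hα, rfl⟩ := Ordinal.mem_toZFSet_iff.1 (show x ∈ (ω_ 2).toZFSet from hx)
    exact H_mono hθ.le (mem_toZFSet_H hα)
  obtain ⟨Nstar, hNC, hcl, N, hNY, hN⟩ := hY.stationary.exists_lift hωH hC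
    (fun e => F e ∪ ({graphOf π} ∪ (elemWitnesses θ e ∪ (skolemValues π Y e ∪ clubSups π Y e))))
    fun e he => ⟨Set.union_subset (hF e he).1 (Set.union_subset
        (Set.singleton_subset_iff.2 (graphOf_mem_H hπ hreg hθ))
        (Set.union_subset (elemWitnesses_subset θ e) (Set.union_subset
          ((skolemValues_subset π Y e).trans (H_mono hθ.le)) (clubSups_subset he)))),
      (hF e he).2.union ((Set.countable_singleton _).union ((elemWitnesses_countable θ e).union
        ((skolemValues_countable π Y e).union (clubSups_countable π Y e))))⟩
  simp only [Set.union_subset_iff] at hcl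
  refine ⟨Nstar, hNC, fun e he => (hcl e he).1, isElemSubmodel_of_closed (hC.subset _ hNC).1
    fun e he => (hcl e he).2.2.1, ?_, N, ?_, hN.symm⟩
  · exact (hcl ∅ (by simp)).2.1 rfl
  have hsub : (N : Set ZFSet.{u}) ⊆ Nstar := hN ▸ Set.inter_subset_left
  refine mem_models.2 ⟨hNY, ?_, fun γ hγ => ?_⟩
  · apply Set.Subset.antisymm
    · rw [← hN]
      exact Set.inter_subset_inter_left _ (Sk_subset_of_closed (hN ▸ hsub)
        fun e he => (hcl e he).2.2.2.1)
    · intro x hx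
      have hxω := (hY.subset N hNY).1 hx
      obtain ⟨α, hα, rfl⟩ := Ordinal.mem_toZFSet_iff.1 hxω
      exact ⟨mem_Sk_of_mem hx (mem_toZFSet_H hα), hxω⟩
  · have hγω := Ordinal.toZFSet_mem_toZFSet_iff.1 ((hY.subset N hNY).1 hγ)
    have hγN : γ.toZFSet ∈ Nstar := hsub hγ
    have h1 : (sSup (clubC π Y ∩ Set.Iio γ)).toZFSet ∈ Nstar := by
      refine (hcl {γ.toZFSet} (by simpa using hγN)).2.2.2.2 ⟨γ, ?_, rfl⟩
      simp [ordsOf]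
    have h2 : sSup (clubC π Y ∩ Set.Iio γ) < ω_ 2 :=
      lt_of_le_of_lt (csSup_le' fun δ hδ => le_of_lt hδ.2) hγω
    change Ordinal.toZFSet _ ∈ (N : Set ZFSet.{u})
    rw [← hN]
    exact ⟨h1, Ordinal.toZFSet_mem_toZFSet_iff.2 h2⟩

end Submodels

/-! ### The forcing relation -/

section ForcingRelation

variable {Q : Type v} [Preorder Q] {x y z : Name.{u} Q} {p q : Q}

theorem fEq.mono (h : fEq x y p) (hq : q ≤ p) : fEq x y q := by
  cases x
  cases y
  exact ⟨fun i r hr => h.1 i r (hr.trans hq), fun j r hr => h.2 j r (hr.trans hq)⟩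

theorem fMem.mono (h : fMem x y p) (hq : q ≤ p) : fMem x y q := by
  cases y
  exact fun r hr => h r (hr.trans hq)

theorem fEq.refl (x : Name.{u} Q) (p : Q) : fEq x x p := by
  induction x generalizing p with
  | mk ι A c ih =>
    exact ⟨fun i q _ hi => ⟨q, le_rfl, i, hi, ih i q⟩, fun i q _ hi => ⟨q, le_rfl, i, hi, ih i q⟩⟩

theorem fEq.symm (h : fEq x y p) : fEq y x p := by
  induction x generalizing y p with
  | mk ι A c ih =>
    cases y with
    | mk κ B d =>
      refine ⟨fun j q hq hj => ?_, fun i q hq hi => ?_⟩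
      · obtain ⟨s, hs, i, hi, h'⟩ := h.2 j q hq hj
        exact ⟨s, hs, i, hi, ih i h'⟩
      · obtain ⟨s, hs, j, hj, h'⟩ := h.1 i q hq hi
        exact ⟨s, hs, j, hj, ih i h'⟩

theorem fEq.trans (h : fEq x y p) (h' : fEq y z p) : fEq x z p := by
  induction x generalizing y z p with
  | mk ι A c ih =>
    cases y with
    | mk κ B d =>
      cases z with
      | mk μ E e =>
        refine ⟨fun i q hq hi => ?_, fun k q hq hk => ?_⟩
        · obtain ⟨s, hs, j, hj, hij⟩ := h.1 i q hq hi
          obtain ⟨t, ht, k, hk, hjk⟩ := h'.1 j s (hs.trans hq) hj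
          exact ⟨t, ht.trans hs, k, hk, ih i (hij.mono ht) hjk⟩
        · obtain ⟨s, hs, j, hj, hjk⟩ := h'.2 k q hq hk
          obtain ⟨t, ht, i, hi, hij⟩ := h.2 j s (hs.trans hq) hj
          exact ⟨t, ht.trans hs, i, hi, ih i hij (hjk.mono ht)⟩

theorem fMem.congr_left (h : fMem x y p) (hx : fEq x z p) : fMem z y p := by
  cases y with
  | mk κ B d =>
    intro q hq
    obtain ⟨s, hs, j, hj, h'⟩ := h q hq
    exact ⟨s, hs, j, hj, (hx.mono (hs.trans hq)).symm.trans h'⟩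

theorem fMem.congr_right (h : fMem x y p) (hy : fEq y z p) : fMem x z p := by
  cases y with
  | mk κ B d =>
    cases z with
    | mk μ E e =>
      intro q hq
      obtain ⟨s, hs, j, hj, h'⟩ := h q hq
      obtain ⟨t, ht, k, hk, hjk⟩ := hy.1 j s (hs.trans hq) hj
      exact ⟨t, ht.trans hs, k, hk, (h'.mono ht).trans hjk⟩

variable [OrderTop Q]

theorem fEq.unordered {x' y' : Name.{u} Q} (hx : fEq x x' p) (hy : fEq y y' p) :
    fEq (Name.unordered x y) (Name.unordered x' y') p := by
  refine ⟨fun i q hq _ => ⟨q, le_rfl, i, le_top, ?_⟩, fun i q hq _ => ⟨q, le_rfl, i, le_top, ?_⟩⟩ <;>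
  · rcases i with ⟨_ | _⟩
    exacts [hy.mono hq, hx.mono hq]

theorem fEq.ordered {x' : Name.{u} Q} (hx : fEq x x' p) (y : Name.{u} Q) :
    fEq (Name.ordered x y) (Name.ordered x' y) p :=
  (hx.unordered hx).unordered (hx.unordered (fEq.refl y p))

theorem fMem_check {a b : ZFSet.{u}} (h : b ∈ a) (p : Q) :
    fMem (Name.check.{u} b) (Name.check.{u} a) p := by
  rw [Name.check.eq_1 a]
  refine fun q _ => ⟨q, le_rfl, equivShrink a ⟨b, h⟩, le_top, ?_⟩
  simpa using fEq.refl _ q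

theorem fMem.exists_check {a : ZFSet.{u}} (h : fMem x (Name.check.{u} a) p) :
    ∃ s ≤ p, ∃ b ∈ a, fEq x (Name.check.{u} b) s := by
  rw [Name.check.eq_1 a] at h
  obtain ⟨s, hs, i, -, h'⟩ := h p le_rfl
  exact ⟨s, hs, _, ((equivShrink a).symm i).2, h'⟩

/-- By `∈`-induction: an element of one set is forced into the canonical name of the other, so some
stronger condition equates it with the canonical name of an actual element. -/
theorem eq_of_fEq_check {a b : ZFSet.{u}}
    (h : fEq (Name.check.{u} a : Name.{u} Q) (Name.check.{u} b) p) : a = b := by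
  induction a using ZFSet.inductionOn generalizing b p with
  | h a ih =>
    have h₁ : ∀ z ∈ a, z ∈ b := fun z hz => by
      obtain ⟨s, -, w, hw, h'⟩ := ((fMem_check hz p).congr_right h).exists_check
      rwa [ih z hz h']
    have h₂ : ∀ w ∈ b, w ∈ a := fun w hw => by
      obtain ⟨s, -, z, hz, h'⟩ := ((fMem_check hw p).congr_right h.symm).exists_check
      rwa [← ih z hz h'.symm]
    ext z
    exact ⟨h₁ z, h₂ z⟩

theorem fSurjection.mono {f a b : Name.{u} Q} (h : fSurjection f a b p) (hq : q ≤ p) :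
    fSurjection f a b q :=
  ⟨fun x r hr => h.1 x r (hr.trans hq), fun x r hr => h.2.1 x r (hr.trans hq),
    fun x r hr => h.2.2.1 x r (hr.trans hq), fun x r hr => h.2.2.2 x r (hr.trans hq)⟩

theorem fSurjection.functional {f a b w w' : Name.{u} Q} (h : fSurjection f a b p)
    (hx : fMem x a p) (hw : fMem w b p) (hw' : fMem w' b p) (h₁ : fMem (.ordered x w) f p)
    (h₂ : fMem (.ordered x w') f p) : fEq w w' p :=
  h.2.2.1 x p le_rfl hx w p le_rfl hw w' p le_rfl hw' p le_rfl ⟨h₁, h₂⟩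

end ForcingRelation

/-! ### Preservation of `ω₁` -/

theorem exists_mem_omega_one_notMem {N : Set ZFSet.{u}} (hN : N.Countable) :
    ∃ ξ ∈ (ω_ 1 : Ordinal.{u}).toZFSet, ξ ∉ N := by
  by_contra! h
  have := card_lt_of_countable (x := (ω_ 1 : Ordinal.{u}).toZFSet) (θ := ℵ_ 1)
    (hN.mono fun x hx => h x hx) aleph_zero_lt_aleph_one
  rw [Ordinal.card_toZFSet, Ordinal.card_omega] at this
  exact this.false

/-- Elements of `ω₁` are countable. -/
theorem countable_of_mem_omega_one {a : ZFSet.{u}} (ha : a ∈ (ω_ 1 : Ordinal.{u}).toZFSet) :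
    (a : Set ZFSet.{u}).Countable := by
  obtain ⟨α, hα, rfl⟩ := Ordinal.mem_toZFSet_iff.1 ha
  rw [← Set.countable_coe_iff, ← mk_le_aleph0_iff]
  have h := lt_omega_iff_card_lt.1 hα
  rw [← Ordinal.card_toZFSet, ← zero_add (1 : Ordinal.{u}), ← succ_aleph, aleph_zero,
    Order.lt_succ_iff] at h
  exact (ZFSet.cardinalMk_coe_sort (x := α.toZFSet)).trans_le (lift_le_aleph0.2 h)

/-- An element of the poset as a condition. -/
def ForcingPoset.cond (Q : ForcingPoset.{u}) (q : ZFSet.{u}) (hq : q ∈ Q.carrier) : Q.Cond :=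
  ⟨q, hq⟩

/-- If strongly generic conditions exist below every condition for enough countable sets, then
`ω₁` is preserved. -/
theorem ForcingPoset.preservesCardinal_omega_one (Q : ForcingPoset.{u}) {X : Set ZFSet.{u}}
    (hcar : (Q.carrier : Set ZFSet.{u}) ⊆ X)
    (hω : ((ω_ 1 : Ordinal.{u}).toZFSet : Set ZFSet.{u}) ⊆ X)
    (hQ : ∀ p ∈ Q.carrier, ∀ F : Finset ZFSet.{u} → Set ZFSet.{u},
      (∀ e, F e ⊆ X ∧ (F e).Countable) → ∃ N : Set ZFSet.{u}, N.Countable ∧ p ∈ N ∧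
        (∀ e : Finset ZFSet.{u}, (e : Set ZFSet.{u}) ⊆ N → F e ⊆ N) ∧
        ∃ q, Q.le q p ∧ Q.IsStronglyGeneric N q) :
    Q.PreservesCardinal (ω_ 1) := by
  intro p₀ p₁ _ hp₁
  obtain ⟨p₂, -, x, hx, hfx⟩ := hp₁ p₁ le_rfl
  obtain ⟨p₃, hp₃, a, ha, hxa⟩ := hx.exists_check
  obtain ⟨p, hp, f, hf⟩ := hfx p₃ hp₃
  replace hxa := hxa.mono hp
  set κ : ZFSet.{u} := (ω_ 1 : Ordinal.{u}).toZFSet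
  let R : Q.Cond → ZFSet.{u} → ZFSet.{u} → Prop := fun t δ ξ =>
    fMem (.ordered (.check δ) (.check ξ)) f t
  let P : ZFSet.{u} → ZFSet.{u} → ZFSet.{u} × ZFSet.{u} → Prop := fun t δ w =>
    Q.le w.1 t ∧ w.2 ∈ κ ∧ ∃ h : w.1 ∈ Q.carrier, R (Q.cond w.1 h) δ w.2
  let wit : ZFSet.{u} → ZFSet.{u} → ZFSet.{u} × ZFSet.{u} := fun t δ => Classical.epsilon (P t δ)
  have hwit : ∀ t δ, (∃ w, P t δ w) → P t δ (wit t δ) := fun t δ h => Classical.epsilon_spec h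
  -- Closure under `F` takes the place of having the name `f` in an elementary submodel: for `t ∈ N`
  -- and `δ ∈ a`, if some extension of `t` decides `f(δ)`, then `N` contains one together with the
  -- value. Countability of `a` allows all `δ` to be treated at once.
  let F : Finset ZFSet.{u} → Set ZFSet.{u} := fun e =>
    ⋃ t ∈ e, ⋃ δ ∈ (a : Set ZFSet.{u}),
      {z | P t δ (wit t δ) ∧ (z = (wit t δ).1 ∨ z = (wit t δ).2)}
  have hF : ∀ e, F e ⊆ X ∧ (F e).Countable := by
    refine fun e => ⟨?_, ?_⟩
    · refine Set.iUnion₂_subset fun t _ => Set.iUnion₂_subset fun δ _ => ?_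
      rintro z ⟨⟨-, h₂, h₁, -⟩, rfl | rfl⟩
      exacts [hcar h₁, hω h₂]
    · refine e.countable_toSet.biUnion fun t _ =>
        (countable_of_mem_omega_one ha).biUnion fun δ _ => ?_
      refine (Set.toFinite {(wit t δ).1, (wit t δ).2}).countable.mono ?_
      rintro z ⟨-, h⟩
      exact h
  obtain ⟨N, hNc, hpN, hNF, q, hqp, hq, hgen⟩ := hQ p.1 p.2 F hF
  obtain ⟨ξ, hξ, hξN⟩ := exists_mem_omega_one_notMem hNc
  have hqp' : Q.cond q hq ≤ p := hqp
  obtain ⟨q₁, hq₁, z, hzx, hzf⟩ := hf.2.2.2 (.check ξ) (Q.cond q hq) hqp' (fMem_check hξ _)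
    (Q.cond q hq) le_rfl
  obtain ⟨q₂, hq₂, δ, hδ, hzδ⟩ :=
    (hzx.congr_right (hxa.mono (hq₁.trans hqp'))).exists_check
  -- The conditions in `N` which decide `f(δ)` to be an element of `N`, or have no extension
  -- deciding it. Strong genericity applies without any definability of `D` in `N`.
  let D : Set ZFSet.{u} := {d | d ∈ N ∧ ∃ h : d ∈ Q.carrier,
    (∃ ξ' ∈ κ, ξ' ∈ N ∧ R (Q.cond d h) δ ξ') ∨ ¬ ∃ w, P d δ w}
  have hD : Q.IsDenseIn N D := by
    refine ⟨fun d hd => ⟨hd.1, hd.2.1⟩, fun t ht => ?_⟩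
    by_cases hex : ∃ w, P t δ w
    · have hw := hwit t δ hex
      have hsub : ∀ z, z = (wit t δ).1 ∨ z = (wit t δ).2 → z ∈ N := fun z hz =>
        hNF {t} (by simpa using ht.1) (Set.mem_biUnion (by simp) (Set.mem_biUnion hδ ⟨hw, hz⟩))
      obtain ⟨hle, hκ, hc, hR⟩ := hw
      exact ⟨_, ⟨hsub _ (Or.inl rfl), hc, Or.inl ⟨_, hκ, hsub _ (Or.inr rfl), hR⟩⟩, hle⟩
    · exact ⟨t, ⟨ht.1, ht.2, Or.inr hex⟩, Q.le_refl t ht.2⟩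
  obtain ⟨d, ⟨-, hd, hdD⟩, w, hw, hwd, hwq⟩ := hgen D hD q₂.1 q₂.2 (hq₂.trans hq₁)
  have hwd' : Q.cond w hw ≤ Q.cond d hd := hwd
  have hwq' : Q.cond w hw ≤ q₂ := hwq
  have hzf' := hzf.mono (hwq'.trans hq₂)
  have hzδ' := hzδ.mono hwq'
  -- The common extension `w` forces `f(δ) = ξ` with `ξ ∉ N`. This contradicts a decision `ξ' ∈ N`
  -- made by `d`, and equally the claim that no extension of `d` decides `f(δ)`.
  rcases hdD with ⟨ξ', hξ', hξ'N, hR⟩ | hno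
  · have hR' : fMem (.ordered z (.check ξ')) f (Q.cond w hw) :=
      (fMem.mono hR hwd').congr_left (hzδ'.symm.ordered _)
    have heq := (hf.mono ((hwq'.trans hq₂).trans (hq₁.trans hqp'))).functional
      (hzx.mono (hwq'.trans hq₂)) (fMem_check hξ _) (fMem_check hξ' _) hzf' hR'
    exact hξN (eq_of_fEq_check heq ▸ hξ'N)
  · exact hno ⟨(w, ξ), hwd, hξ, hw, hzf'.congr_left (hzδ'.ordered _)⟩

theorem isClubOfCountable_all {α : Type v} (X : Set α) :
    IsClubOfCountable X {a | a ⊆ X ∧ a.Countable} where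
  subset _ h := h
  cofinal b h hb := ⟨b, ⟨h, hb⟩, subset_rfl⟩
  closed _ _ h := ⟨Set.iUnion_subset fun n => (h n).1, Set.countable_iUnion fun n => (h n).2⟩

section Main

variable {π : Ordinal.{u} → ZFSet.{u}} {Y : ZFSet.{u}} {Γ : Set Ordinal.{u}}

theorem exists_ge_of_isStationary_Iio
    (h : IsStationary {β : Set.Iio (ω_ 2 : Ordinal.{u}) | β.1 ∈ Γ}) :
    ∀ α < ω_ 2, ∃ β ∈ Γ, α ≤ β := fun α hα =>
  let ⟨β, hβ, hαβ⟩ := exists_ge_of_isStationary h ⟨α, hα⟩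
  ⟨β.1, hβ, hαβ⟩

theorem insert_isStronglyGeneric (hπ : Set.BijOn π (Set.Iio (ω_ 2)) (H (ℵ_ 2)))
    (hY : IsThinStationary Y) (hΓ : Γ ⊆ Lam π Y) (hunb : ∀ α < ω_ 2, ∃ β ∈ Γ, α ≤ β)
    {θ : Cardinal.{u}} (hθ : ℵ_ 2 < θ) {Nstar : Set ZFSet.{u}} (hNstar : IsElemSubmodel θ Nstar)
    (hgraph : graphOf π ∈ Nstar) {N : ZFSet.{u}} (hN : N ∈ models π Y)
    (hNeq : (N : Set ZFSet.{u}) = Nstar ∩ ((ω_ 2).toZFSet : ZFSet.{u})) {A : ZFSet.{u}}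
    (hA : A ∈ Nstar ∩ (adequatePoset π Y Γ).carrier) :
    (adequatePoset π Y Γ).le (insert N A) A ∧
      (adequatePoset π Y Γ).IsStronglyGeneric Nstar (insert N A) := by
  have htr := hNstar.inter_H_eq hπ hθ hgraph (mem_models.1 hN).2.1 hNeq
  have hAN : A ∈ Sk π Y N := htr ▸ ⟨hA.1, mem_H_of_mem_adequatePoset hY hA.2⟩
  exact ⟨fun _ h => ZFSet.mem_insert_of_mem _ h, isStronglyGeneric_of_mem hπ hY hΓ hunb htr
    (insert_mem_adequatePoset hπ hY hN hA.2 hAN) (ZFSet.mem_insert _ _)⟩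

end Main

end AdequateForcing

open AdequateForcing in
theorem proposition4p2
    (hpow : (2 : Cardinal.{u}) ^ (ℵ_ 1 : Cardinal.{u}) = ℵ_ 2)
    (π : Ordinal.{u} → ZFSet.{u})
    (hπ : Set.BijOn π (Set.Iio (ω_ 2)) (H (ℵ_ 2)))
    (Y : ZFSet.{u}) (hY : IsThinStationary Y)
    (Γ : Set Ordinal.{u}) (hΓ : Γ ⊆ Lam π Y)
    (hΓstat : IsStationary {β : Set.Iio (ω_ 2 : Ordinal.{u}) | β.1 ∈ Γ}) :
    (adequatePoset π Y Γ).IsStronglyProperOnStationary ∧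
    (∀ θ : Cardinal.{u}, θ.IsRegular → ℵ_ 2 < θ →
      ∀ Nstar : Set ZFSet.{u}, Nstar.Countable → IsElemSubmodel θ Nstar →
        (adequatePoset π Y Γ).carrier ∈ Nstar → graphOf π ∈ Nstar → models π Y ∈ Nstar →
      ∀ N ∈ models π Y, (N : Set ZFSet.{u}) = Nstar ∩ ((ω_ 2).toZFSet : ZFSet.{u}) →
      ∀ A ∈ Nstar ∩ (adequatePoset π Y Γ).carrier,
        (adequatePoset π Y Γ).le (insert N A) A ∧
        (adequatePoset π Y Γ).IsStronglyGeneric Nstar (insert N A)) ∧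
    (adequatePoset π Y Γ).PreservesCardinal (ω_ 1) := by
  have hunb := exists_ge_of_isStationary_Iio hΓstat
  refine ⟨⟨Order.succ (ℵ_ 2), fun θ hθ hreg _ C hC => ?_⟩, ?_, ?_⟩
  · have hθ' := Order.succ_le_iff.1 hθ
    obtain ⟨Nstar, hNC, -, hel, hgraph, N, hN, hNeq⟩ := exists_submodel hπ hY hreg hθ' hC
      (fun _ => ∅) fun _ _ => ⟨Set.empty_subset _, Set.countable_empty⟩
    exact ⟨Nstar, ⟨(hC.subset _ hNC).2, hel, fun p hp => ⟨insert N p,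
      insert_isStronglyGeneric hπ hY hΓ hunb hθ' hel hgraph hN hNeq hp⟩⟩, hNC⟩
  · intro θ _ hθ Nstar _ hel _ hgraph _ N hN hNeq A hA
    exact insert_isStronglyGeneric hπ hY hΓ hunb hθ hel hgraph hN hNeq hA
  · have hθ : ℵ_ 2 < Order.succ (ℵ_ 2 : Cardinal.{u}) := Order.lt_succ _
    have hreg := isRegular_succ (isRegular_aleph_two.{u}).aleph0_le
    refine ForcingPoset.preservesCardinal_omega_one _
      (X := H (ℵ_ 2)) (fun A hA => mem_H_of_mem_adequatePoset hY hA) (fun x hx => ?_) ?_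
    · obtain ⟨α, hα, rfl⟩ := Ordinal.mem_toZFSet_iff.1 (show x ∈ (ω_ 1).toZFSet from hx)
      exact mem_toZFSet_H (hα.trans (omega_lt_omega.2 one_lt_two))
    · intro p hp F hF
      -- Adding `{p}` to every value of `F` forces `p` into the submodel.
      obtain ⟨Nstar, hNC, hcl, hel, hgraph, N, hN, hNeq⟩ := exists_submodel hπ hY hreg hθ
        (isClubOfCountable_all _) (fun e => F e ∪ {p}) fun e _ =>
          ⟨Set.union_subset ((hF e).1.trans (H_mono hθ.le)) (Set.singleton_subset_iff.2
            (H_mono hθ.le (mem_H_of_mem_adequatePoset hY hp))),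
            (hF e).2.union (Set.countable_singleton p)⟩
      have hpN : p ∈ Nstar := hcl ∅ (by simp) (Or.inr rfl)
      exact ⟨Nstar, hNC.2, hpN, fun e he => Set.subset_union_left.trans (hcl e he), insert N p,
        insert_isStronglyGeneric hπ hY hΓ hunb hθ hel hgraph hN hNeq ⟨hpN, hp⟩⟩
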